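/- Let $S^3=\{(u,v)\in\mathbb C^2 : |u|^2+|v|^2=1\}$, oriented as the boundary of the unit ball of $\mathbb C^2=\mathbb R^4$ (outward normal first, real coordinates $(\mathrm{Re}\,u,\mathrm{Im}\,u,\mathrm{Re}\,v,\mathrm{Im}\,v)$), let $D^2\subset\mathbb C$ be the closed unit disk, and let $L\subset S^3$ be the image of $S^1\to S^3$, $z\mapsto(z,0)$. Let $n\neq0$ be an integer and $\epsilon>0$. Put $$j(z,w)=\frac{1}{\sqrt{1+|\epsilon w|^2}}\,(z,\epsilon w z^n),\qquad (z,w)\in S^1\times D^2,\qquad U=j(S^1\times D^2).$$ This is a smooth embedding onto a closed tubular neighborhood $U$ of $L$ which sends $S^1\times\{0\}$ to $L$ and $S^1\times\{1\}$ to a knot whose linking number with $L$ is $n$. The surgery on $L$ with framing $n$ is the closed connected 3-manifold $$S^3_{(L,n)}=\bigl((S^3-\mathrm{int}\,U)\sqcup (D^2\times S^1)\bigr)/(x\sim j(x),\ x\in S^1\times S^1).$$ Regard $S^3-L$ as the dense open subset of $S^3_{(L,n)}$ that is the complement of $\{0\}\times S^1\subset D^2\times S^1$: a point of $S^3-\mathrm{int}\,U$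 is regarded as its class, and $j(z,tw)$, for $z,w\in S^1$ and $0<t\le1$, as the class of $(tz,w)\in D^2\times S^1$. Let $S^3_{(L,n)}$ carry the orientation that extends the one of $S^3-U$. Let $\mathbb Z_{|n|}$ act on $S^3$ by multiplication with the $|n|$-th roots of unity, and let the lens space $S^3/\mathbb Z_{|n|}$ carry the orientation inherited from $S^3$. Then the map $$i_n:\ S^3-L\to (S^3-L)/\mathbb Z_{|n|},\qquad (u,v)\mapsto\Bigl(\frac v{|v|}\Bigr)^{-1/n}(u,|v|)$$ is independent of the choice of the $n$-th root, and it extends uniquely to a homeomorphism from $S^3_{(L,n)}$ onto $S^3/\mathbb Z_{|n|}$. The degree of this homeomorphism is $-\mathrm{sign}(n)$. In particular, for $n=-2$, the map $i_{-2}$ extends uniquely to a homeomorphism from $S^3_{(L,-2)}$ onto $\mathbb RP^3=S^3/\{\pm1\}$, and this homeomorphism has degree one. -/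

import Mathlib

open scoped Manifold ContDiff Topology

noncomputable section

namespace UnknotSurgery

/-! ### The 3-sphere, its orientation, the unknot -/

/-- Euclidean 3-space, the model space for charts. -/
abbrev E3 : Type := EuclideanSpace ℝ (Fin 3)

/-- The unit sphere of `ℂ²`. -/
def S3 : Set (ℂ × ℂ) := {p | ‖p.1‖ ^ 2 + ‖p.2‖ ^ 2 = 1}

/-- The closed unit disk in `ℂ`. -/
abbrev D2 : Type := Metric.closedBall (0 : ℂ) 1

/-- The unknot: the image of `z ↦ (z, 0)`, `S¹ → S³`. -/
def unknot : Set (ℂ × ℂ) := Set.range fun z : Circle => ((z : ℂ), (0 : ℂ))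

/-- The identification `(x₁ + i y₁, x₂ + i y₂) ↦ (x₁, y₁, x₂, y₂)` of `ℂ²` with `ℝ⁴`. -/
def realCoords (p : ℂ × ℂ) : Fin 4 → ℝ := ![p.1.re, p.1.im, p.2.re, p.2.im]

/-- The determinant of `(p, b₁, b₂, b₃)` in `ℂ² = ℝ⁴`. At a point `p` of the sphere the vector `p`
is the outward normal, so (outward normal first) a basis `b₁, b₂, b₃` of the tangent space at `p` is
positively oriented if and only if this number is positive. -/
def orientationDet (p b₁ b₂ b₃ : ℂ × ℂ) : ℝ :=
  Matrix.det (Matrix.of ![realCoords p, realCoords b₁, realCoords b₂, realCoords b₃])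

theorem snd_ne_zero (p : ↥(S3 \ unknot)) : p.1.2 ≠ 0 := by
  intro h
  apply p.2.2
  have h1 : ‖p.1.1‖ ^ 2 + ‖p.1.2‖ ^ 2 = 1 := p.2.1
  rw [h] at h1
  have h2 : ‖p.1.1‖ = 1 := by
    have : ‖p.1.1‖ ^ 2 = 1 := by simpa using h1
    nlinarith [norm_nonneg p.1.1]
  refine ⟨⟨p.1.1, by simp [Submonoid.unitSphere, h2]⟩, ?_⟩
  exact Prod.ext rfl h.symm

/-! ### Oriented manifolds and the degree of a map -/

section Degree

variable {M N : Type*} [TopologicalSpace M] [TopologicalSpace N]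

/-- `A` is an oriented smooth atlas that makes `M` a closed connected oriented 3-manifold. -/
structure IsClosedOrientedManifold (A : Set (OpenPartialHomeomorph M E3)) : Prop where
  compact : CompactSpace M
  hausdorff : T2Space M
  connected : ConnectedSpace M
  cover : ∀ x : M, ∃ e ∈ A, x ∈ e.source
  smooth : ∀ e ∈ A, ∀ e' ∈ A, ContDiffOn ℝ ∞ (e' ∘ e.symm) (e.symm.trans e').source
  oriented : ∀ e ∈ A, ∀ e' ∈ A, ∀ y ∈ (e.symm.trans e').source,
    0 < (fderiv ℝ (e' ∘ e.symm) y).det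

/-- `f` is smooth in the charts of `A` and `B`. -/
def IsSmoothMap (A : Set (OpenPartialHomeomorph M E3)) (B : Set (OpenPartialHomeomorph N E3))
    (f : C(M, N)) : Prop :=
  ∀ e ∈ A, ∀ e' ∈ B,
    ContDiffOn ℝ ∞ (e' ∘ f ∘ e.symm) (e.target ∩ e.symm ⁻¹' (f ⁻¹' e'.source))

/-- The Jacobian determinant of `f` at `x`, read in the charts `e` and `e'`. -/
def jacobian (e : OpenPartialHomeomorph M E3) (e' : OpenPartialHomeomorph N E3) (f : C(M, N))
    (x : M) : ℝ :=
  (fderiv ℝ (e' ∘ f ∘ e.symm) (e x)).det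

/-- `y` is a regular value of `f`. -/
def IsRegularValue (A : Set (OpenPartialHomeomorph M E3)) (B : Set (OpenPartialHomeomorph N E3))
    (f : C(M, N)) (y : N) : Prop :=
  ∀ x : M, f x = y → ∀ e ∈ A, ∀ e' ∈ B, x ∈ e.source → y ∈ e'.source → jacobian e e' f x ≠ 0

open Classical in
/-- The sign (`1`, `-1` or `0`) of the Jacobian determinant of `f` at `x` in oriented charts. -/
def localSign (A : Set (OpenPartialHomeomorph M E3)) (B : Set (OpenPartialHomeomorph N E3))
    (f : C(M, N)) (x : M) : ℤ :=
  if ∃ e ∈ A, ∃ e' ∈ B, x ∈ e.source ∧ f x ∈ e'.source ∧ 0 < jacobian e e' f x then 1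
  else if ∃ e ∈ A, ∃ e' ∈ B, x ∈ e.source ∧ f x ∈ e'.source ∧ jacobian e e' f x < 0 then -1
  else 0

/-- The continuous map `f` between closed connected oriented manifolds has degree `d`: it is
homotopic to a smooth map `g` such that, for every regular value `y` of `g`, the points of
`g⁻¹(y)`, counted with the sign of the Jacobian, add up to `d`. -/
def HasDegree (A : Set (OpenPartialHomeomorph M E3)) (B : Set (OpenPartialHomeomorph N E3))
    (f : C(M, N)) (d : ℤ) : Prop :=
  ∃ g : C(M, N), f.Homotopic g ∧ IsSmoothMap A B g ∧ (∃ y, IsRegularValue A B g y) ∧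
    ∀ y, IsRegularValue A B g y → ∑ᶠ x ∈ g ⁻¹' {y}, localSign A B g x = d

/-- `φ` is a smooth local lift of the parametrization `e.symm` of `M` through the map
`π : X → M`, taking the value `x` at the point of `E3` that corresponds to `π x`. Here `X` is
regarded as a subset of `ℂ²` by means of `ι`. -/
def IsSmoothLiftAt {X : Type*} (ι : X → ℂ × ℂ) (π : X → M) (e : OpenPartialHomeomorph M E3)
    (x : X) (φ : E3 → ℂ × ℂ) : Prop :=
  ContDiffAt ℝ ∞ φ (e (π x)) ∧ φ (e (π x)) = ι x ∧
    ∀ᶠ y in 𝓝 (e (π x)), ∃ x' : X, ι x' = φ y ∧ π x' = e.symm y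

/-- At `y`, the map `φ` is a positively oriented local parametrization of the 3-sphere. -/
def IsPositiveAt (φ : E3 → ℂ × ℂ) (y : E3) : Prop :=
  0 < orientationDet (φ y) (fderiv ℝ φ y (EuclideanSpace.single 0 1))
    (fderiv ℝ φ y (EuclideanSpace.single 1 1)) (fderiv ℝ φ y (EuclideanSpace.single 2 1))

end Degree

/-! ### Linking numbers and surgery -/

/-- The velocity at `z` of a closed curve parametrized by the circle. -/
def velocity (γ : Circle → S3) (z : Circle) : ℂ × ℂ :=
  deriv (fun θ : ℝ => (γ (z * Circle.exp θ) : ℂ × ℂ)) 0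

/-- The disjoint oriented closed curves `γ`, `γ'` in the 3-sphere have linking number `m`: there is
a smooth map `F` of the closed disk to the sphere with boundary curve `γ`, transverse to `γ'`,
whose algebraic number of intersections with `γ'` is `m`. -/
def HasLinkingNumber (γ γ' : Circle → S3) (m : ℤ) : Prop :=
  (∀ z w, γ z ≠ γ' w) ∧
  ∃ (F : ℂ → ℂ × ℂ) (V : Set ℂ), IsOpen V ∧ Metric.closedBall 0 1 ⊆ V ∧ ContDiffOn ℝ ∞ F V ∧
    (∀ a ∈ Metric.closedBall (0 : ℂ) 1, F a ∈ S3) ∧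
    (∀ z : Circle, F z = γ z) ∧
    (∀ a ∈ Metric.closedBall (0 : ℂ) 1, ∀ z : Circle, F a = γ' z →
      orientationDet (F a) (fderiv ℝ F a 1) (fderiv ℝ F a Complex.I) (velocity γ' z) ≠ 0) ∧
    ∑ᶠ x ∈ {x : ℂ × Circle | x.1 ∈ Metric.closedBall (0 : ℂ) 1 ∧ F x.1 = γ' x.2},
      ((SignType.sign (orientationDet (F x.1) (fderiv ℝ F x.1 1) (fderiv ℝ F x.1 Complex.I)
        (velocity γ' x.2)) : SignType) : ℤ) = m

/-- The inclusion of the circle as the boundary of the disk. -/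
def toDisk (z : Circle) : D2 := ⟨(z : ℂ), by rw [mem_closedBall_zero_iff, Circle.norm_coe]⟩

/-- The center of the disk. -/
def center : D2 := ⟨0, by simp⟩

/-- `j` is a smooth embedding of `S¹ × D²` onto a closed tubular neighborhood of the knot `L`, it
sends `S¹ × {0}` to `L`, and it sends `S¹ × {1}` to a knot whose linking number with `L` is `n`. -/
structure IsFramedTube (L : Set (ℂ × ℂ)) (n : ℤ) (j : Circle × D2 → S3) : Prop where
  embedding : Topology.IsEmbedding j
  smooth : ∃ (J : ℂ × ℂ → ℂ × ℂ) (V : Set (ℂ × ℂ)), IsOpen V ∧ ContDiffOn ℝ ∞ J V ∧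
    ∀ (z : Circle) (w : D2), ((z : ℂ), (w : ℂ)) ∈ V ∧ J ((z : ℂ), (w : ℂ)) = j (z, w) ∧
      ∀ (a : ℝ) (b : ℂ), fderiv ℝ J ((z : ℂ), (w : ℂ)) (a * Complex.I * z, b) = 0 →
        a = 0 ∧ b = 0
  core : Set.range (fun z : Circle => (j (z, center) : ℂ × ℂ)) = L
  neighborhood : ∀ p : S3, (p : ℂ × ℂ) ∈ L → p ∈ interior (Set.range j)
  linking : HasLinkingNumber (fun z => j (z, center)) (fun z => j (z, toDisk 1)) n

/-- The gluing relation of surgery: a point of `S¹ × S¹`, regarded as a boundary point of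
`D² × S¹`, is identified with its image under `j`. -/
def gluing (j : Circle × D2 → S3) :
    {p : S3 // p ∉ interior (Set.range j)} ⊕ (D2 × Circle) →
    {p : S3 // p ∉ interior (Set.range j)} ⊕ (D2 × Circle) → Prop :=
  fun a b => ∃ (p : {p : S3 // p ∉ interior (Set.range j)}) (z w : Circle),
    a = Sum.inl p ∧ b = Sum.inr (toDisk z, w) ∧ p.1 = j (z, toDisk w)

/-- The result of the surgery along `j`: the complement of the interior of the image of `j` is
glued to `D² × S¹` along `S¹ × S¹` via `j`. -/
abbrev Surgery (j : Circle × D2 → S3) : Type := Quot (gluing j)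

/-! ### The surgery on the unknot with framing `n` -/

/-- The embedding `j(z, w) = (1 + |εw|²)^(-1/2) (z, ε w zⁿ)` of `S¹ × D²`. -/
def tube (ε : ℝ) (n : ℤ) (x : Circle × D2) : S3 :=
  ⟨((1 / √(1 + ‖(ε : ℂ) * (x.2 : ℂ)‖ ^ 2) : ℝ) : ℂ) •
      ((x.1 : ℂ), (ε : ℂ) * (x.2 : ℂ) * (x.1 : ℂ) ^ n), by
    have h : (0 : ℝ) < 1 + ‖(ε : ℂ) * (x.2 : ℂ)‖ ^ 2 := by positivity
    have h2 := Real.sq_sqrt h.le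
    have h3 := Real.sqrt_pos.2 h
    simp only [S3, Set.mem_ofPred_eq, Prod.smul_fst, Prod.smul_snd, smul_eq_mul, norm_mul,
      Complex.norm_real, norm_zpow, Circle.norm_coe, one_zpow, mul_one, Real.norm_eq_abs, mul_pow,
      sq_abs] at h h2 h3 ⊢
    rw [one_div, inv_pow, h2]
    field_simp⟩

theorem norm_snd_le_of_mem_range {ε : ℝ} {n : ℤ} {p : S3} (h : p ∈ Set.range (tube ε n)) :
    p.1.1 ≠ 0 ∧ ‖p.1.2‖ ≤ |ε| * ‖p.1.1‖ := by
  obtain ⟨⟨z, w⟩, rfl⟩ := h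
  have h : (0 : ℝ) < 1 + ‖(ε : ℂ) * (w : ℂ)‖ ^ 2 := by positivity
  have h3 := Real.sqrt_pos.2 h
  have hw : ‖(w : ℂ)‖ ≤ 1 := mem_closedBall_zero_iff.1 w.2
  constructor
  · simp only [tube, Prod.smul_fst, smul_eq_mul]
    refine mul_ne_zero ?_ (Circle.coe_ne_zero z)
    exact_mod_cast (one_div_pos.2 h3).ne'
  · simp only [tube, Prod.smul_fst, Prod.smul_snd, smul_eq_mul, norm_mul, norm_zpow, Circle.norm_coe,
      one_zpow, mul_one, Complex.norm_real, Real.norm_eq_abs]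
    exact le_of_le_of_eq (mul_le_mul_of_nonneg_left
      (mul_le_of_le_one_right (abs_nonneg ε) hw) (abs_nonneg _)) (mul_comm _ _)

/-- `v / |v|` as a point of the circle. -/
def unitPart (v : ℂ) (hv : v ≠ 0) : Circle :=
  ⟨v / (‖v‖ : ℂ), by simp [Submonoid.unitSphere, hv]⟩

open Classical in
/-- The complement of the unknot as a subset of the surgered manifold: outside the interior of the
tube it is the identity, and inside the tube the point `j(z, t w)` with `|z| = |w| = 1`, `0 < t < 1`
is regarded as the point `(t z, w)` of `D² × S¹`. -/
def complementInclusion (ε : ℝ) (n : ℤ) (p : ↥(S3 \ unknot)) : Surgery (tube ε n) :=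
  if h : (⟨p.1, p.2.1⟩ : S3) ∈ interior (Set.range (tube ε n)) then
    have hu := norm_snd_le_of_mem_range (interior_subset h)
    Quot.mk _ (Sum.inr
      (⟨((‖p.1.2‖ / (ε * ‖p.1.1‖) : ℝ) : ℂ) * (unitPart p.1.1 hu.1 : ℂ), by
          rw [mem_closedBall_zero_iff, norm_mul, Circle.norm_coe, mul_one, Complex.norm_real,
            norm_div, norm_mul, norm_norm, norm_norm, Real.norm_eq_abs]
          exact div_le_one_of_le₀ hu.2 (by positivity)⟩,
        unitPart p.1.2 (snd_ne_zero p) * unitPart p.1.1 hu.1 ^ (-n)))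
  else Quot.mk _ (Sum.inl ⟨⟨p.1, p.2.1⟩, h⟩)

/-- The oriented smooth charts of the surgered manifold: those that are smooth and positively
oriented on the complement of the unknot, with the orientation of the 3-sphere, and smooth on the
interior of `D² × S¹`. -/
def surgeryAtlas (ε : ℝ) (n : ℤ) : Set (OpenPartialHomeomorph (Surgery (tube ε n)) E3) :=
  {e | (∀ p : ↥(S3 \ unknot), complementInclusion ε n p ∈ e.source →
          ∃ φ, IsSmoothLiftAt Subtype.val (complementInclusion ε n) e p φ ∧
            IsPositiveAt φ (e (complementInclusion ε n p))) ∧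
       ∀ x : D2 × Circle, ‖(x.1 : ℂ)‖ < 1 → Quot.mk _ (Sum.inr x) ∈ e.source →
          ∃ φ, IsSmoothLiftAt (fun x : D2 × Circle => ((x.1 : ℂ), (x.2 : ℂ)))
              (fun x => Quot.mk _ (Sum.inr x)) e x φ ∧
            Function.Injective (fderiv ℝ φ (e (Quot.mk _ (Sum.inr x))))}

/-! ### Lens spaces, projective space, and the map `i_n` -/

/-- The generator `ζ = exp(2πi/|n|)` of the group of `|n|`-th roots of unity. -/
def zeta (n : ℤ) : ℂ := Complex.exp (2 * Real.pi * Complex.I / (|n| : ℤ))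

theorem zeta_ne_zero (n : ℤ) : zeta n ≠ 0 := Complex.exp_ne_zero _

/-- Points of the 3-sphere in the same orbit of the action of `ℤ/|n|` generated by
`(u, v) ↦ (ζu, ζv)`. -/
def lensSetoid (n : ℤ) : Setoid S3 where
  r p q := ∃ k : ℤ, q.1 = zeta n ^ k • p.1
  iseqv :=
    { refl := fun p => ⟨0, by simp⟩
      symm := by
        rintro p q ⟨k, h⟩
        refine ⟨-k, ?_⟩
        rw [h, smul_smul, ← zpow_add₀ (zeta_ne_zero n)]
        simp
      trans := by
        rintro p q r ⟨k, h⟩ ⟨l, h'⟩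
        refine ⟨l + k, ?_⟩
        rw [h', h, smul_smul, ← zpow_add₀ (zeta_ne_zero n)] }

/-- Antipodal points of the 3-sphere. -/
def antipodalSetoid : Setoid S3 where
  r p q := q.1 = p.1 ∨ q.1 = -p.1
  iseqv :=
    { refl := fun p => Or.inl rfl
      symm := by
        rintro p q (h | h)
        · exact Or.inl h.symm
        · exact Or.inr (by rw [h, neg_neg])
      trans := by
        rintro p q r (h | h) (h' | h') <;> rw [h'] <;> simp [h] }

/-- The lens space `S³ / ℤ_{|n|}`. -/
abbrev Lens (n : ℤ) : Type := Quotient (lensSetoid n)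

/-- Real projective 3-space. -/
abbrev RP3 : Type := Quotient antipodalSetoid

/-- The oriented smooth charts that a quotient of the 3-sphere inherits from the sphere. -/
def quotientAtlas (s : Setoid S3) : Set (OpenPartialHomeomorph (Quotient s) E3) :=
  {e | ∀ p : S3, Quotient.mk s p ∈ e.source →
    ∃ φ, IsSmoothLiftAt Subtype.val (Quotient.mk s) e p φ ∧ IsPositiveAt φ (e (Quotient.mk s p))}

/-- `(v/|v|)^(-1/n) (u, |v|)`, with the principal branch of the root. -/
def rootMap (n : ℤ) (p : ↥(S3 \ unknot)) : S3 :=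
  ⟨((p.1.2 / (‖p.1.2‖ : ℂ)) ^ (-1 / (n : ℂ))) • (p.1.1, (‖p.1.2‖ : ℂ)), by
    have h0 : (‖p.1.2‖ : ℝ) ≠ 0 := norm_ne_zero_iff.2 (snd_ne_zero p)
    have h1 : p.1.2 / (‖p.1.2‖ : ℂ) ≠ 0 :=
      div_ne_zero (snd_ne_zero p) (by exact_mod_cast h0)
    have h2 : ‖p.1.2 / (‖p.1.2‖ : ℂ)‖ = 1 := by
      rw [norm_div, Complex.norm_real, norm_norm, div_self h0]
    have h3 : (-1 / (n : ℂ)) = ((-1 / (n : ℝ) : ℝ) : ℂ) := by push_cast; rfl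
    have h4 : ‖(p.1.2 / (‖p.1.2‖ : ℂ)) ^ (-1 / (n : ℂ))‖ = 1 := by
      rw [Complex.norm_cpow_of_ne_zero h1, h2, h3]
      simp only [Complex.ofReal_re, Complex.ofReal_im, Real.one_rpow]
      simp
    have h5 : ‖p.1.1‖ ^ 2 + ‖p.1.2‖ ^ 2 = 1 := p.2.1
    simpa only [S3, Set.mem_ofPred_eq, Prod.smul_fst, Prod.smul_snd, smul_eq_mul, norm_mul, h4,
      one_mul, Complex.norm_real, norm_norm] using h5⟩

/-- The map `i_n` from the complement of the unknot to the lens space. -/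
def iMap (n : ℤ) (p : ↥(S3 \ unknot)) : Lens n := Quotient.mk (lensSetoid n) (rootMap n p)

end UnknotSurgery

end

open UnknotSurgery

open scoped Manifold ContDiff Topology

noncomputable section

namespace UnknotSurgery

/-! ### Orientation determinants -/

/-! The surgered manifold turns out to be the same quotient of the sphere as the lens space, with
the orientation multiplied by the sign of `-n`.

Off the unknot, `i_n` is inverted by an explicit map: the phase of the second coordinate of `c • (u,
|v|)` is `c`, and `c ^ (-n)` is the phase of `v`. So `rootInv`, which sends `(a, b)` to `(a β⁻¹, |b|
β ^ (-n))` with `β = b / |b|`, recovers `(u, v)` and does not see roots of unity.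

The extension over the glued solid torus comes from one computation (`iMap_eq_coreMap`). The point
`j(z, r w)` is proportional to `(z, ε r w zⁿ)` and `i_n` sends it to the class of a normalized
multiple of `(z, ε r)` by a root `c` of `w⁻¹ z⁻ⁿ`. Put `a = r z` and `b = c z`; then `b ^ n = w⁻¹`,
and the class is that of `b (1, ε ā)`, normalized. This expression makes sense at `a = 0` and
defines `coreMap`. The glued map `toLens` is a continuous bijection from a compact space to a
Hausdorff space, hence a homeomorphism; it is the only extension because the complement of the
unknot is dense.

For the degree, the inverse homeomorphism makes the surgered manifold a quotient of the sphere via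
`toSurgery`, and the extension is then covered by the identity of the sphere. What remains is to
compare orientations. `paramDet_rootInv_comp` shows that `rootInv` multiplies oriented volume by
`-n`; `surgeryAtlas_eq` concludes that the surgery charts are those of the sphere with orientation
multiplied by the sign of `-n`, where the sign at the core follows by continuity. A homeomorphism
has one preimage over each point, so the degree is this sign (`hasDegree_of_lift`).

That the tube has framing `n` is checked with a hemisphere spanning the unknot: it meets the
pushed-off curve exactly where `zⁿ = 1`, transversely, with sign `sign n` each time. -/

theorem orientationDet_apply (p a b c : ℂ × ℂ) : orientationDet p a b c =
    p.1.re * (a.1.im * (b.2.re * c.2.im - b.2.im * c.2.re)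
      - a.2.re * (b.1.im * c.2.im - b.2.im * c.1.im)
      + a.2.im * (b.1.im * c.2.re - b.2.re * c.1.im))
    - p.1.im * (a.1.re * (b.2.re * c.2.im - b.2.im * c.2.re)
      - a.2.re * (b.1.re * c.2.im - b.2.im * c.1.re)
      + a.2.im * (b.1.re * c.2.re - b.2.re * c.1.re))
    + p.2.re * (a.1.re * (b.1.im * c.2.im - b.2.im * c.1.im)
      - a.1.im * (b.1.re * c.2.im - b.2.im * c.1.re)
      + a.2.im * (b.1.re * c.1.im - b.1.im * c.1.re))
    - p.2.im * (a.1.re * (b.1.im * c.2.re - b.2.re * c.1.im)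
      - a.1.im * (b.1.re * c.2.re - b.2.re * c.1.re)
      + a.2.re * (b.1.re * c.1.im - b.1.im * c.1.re)) := by
  simp [orientationDet, realCoords, Matrix.det_succ_row_zero, Fin.sum_univ_succ, Fin.succAbove]
  ring

/-- The orientation determinant of the images of the standard basis vectors of `E3`. -/
def frameDet (p : ℂ × ℂ) (T : E3 → ℂ × ℂ) : ℝ :=
  orientationDet p (T (EuclideanSpace.single 0 1)) (T (EuclideanSpace.single 1 1))
    (T (EuclideanSpace.single 2 1))

/-- The determinant whose sign decides whether a local parametrization of the sphere is positively
oriented. -/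
def paramDet (φ : E3 → ℂ × ℂ) (y : E3) : ℝ := frameDet (φ y) (fderiv ℝ φ y)

/-- Multiplication by `c` and `d` on the two factors is a real-linear map of `ℝ⁴` with determinant
`|c|² |d|²`; in particular rotations do not matter. -/
theorem frameDet_prodMap_smul (c d : ℂ) (p : ℂ × ℂ) (T : E3 → ℂ × ℂ) :
    frameDet (c * p.1, d * p.2) (fun x => (c * (T x).1, d * (T x).2)) =
      ‖c‖ ^ 2 * ‖d‖ ^ 2 * frameDet p T := by
  simp only [frameDet, orientationDet_apply, ← Complex.normSq_eq_norm_sq, Complex.normSq_apply,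
    Complex.mul_re, Complex.mul_im]
  ring

theorem frameDet_smul {c : ℂ} (hc : ‖c‖ = 1) (p : ℂ × ℂ) (T : E3 → ℂ × ℂ) :
    frameDet (c • p) (fun x => c • T x) = frameDet p T := by
  have := frameDet_prodMap_smul c c p T
  rwa [hc, one_pow, one_mul, one_mul] at this

/-- The map applied to all four vectors is real-linear and block triangular with determinant `m`. Up
to rotations the derivative of `rootInv` has this shape, with `m = -n`. -/
theorem frameDet_shear (s : ℂ) (m : ℝ) (p : ℂ × ℂ) (T : E3 → ℂ × ℂ) :
    frameDet (p.1 - s * (p.2.im : ℂ), ⟨p.2.re, m * p.2.im⟩)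
      (fun x => ((T x).1 - s * ((T x).2.im : ℂ), ⟨(T x).2.re, m * (T x).2.im⟩)) =
      m * frameDet p T := by
  simp only [frameDet, orientationDet_apply, Complex.sub_re, Complex.sub_im,
    Complex.re_mul_ofReal, Complex.im_mul_ofReal]
  ring

theorem E3.eq_sum (x : E3) : x = x 0 • EuclideanSpace.single 0 (1 : ℝ) +
    x 1 • EuclideanSpace.single 1 (1 : ℝ) + x 2 • EuclideanSpace.single 2 (1 : ℝ) := by
  ext i
  fin_cases i <;> simp

theorem map_E3 {F : Type*} [AddCommGroup F] [Module ℝ F] (T : E3 →ₗ[ℝ] F) (x : E3) :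
    T x = x 0 • T (EuclideanSpace.single 0 (1 : ℝ)) +
      x 1 • T (EuclideanSpace.single 1 (1 : ℝ)) + x 2 • T (EuclideanSpace.single 2 (1 : ℝ)) := by
  conv_lhs => rw [E3.eq_sum x]
  simp only [map_add, map_smul]

theorem E3.det_eq (A : E3 →L[ℝ] E3) :
    A.det = Matrix.det (Matrix.of fun i j : Fin 3 => A (EuclideanSpace.single j 1) i) := by
  rw [ContinuousLinearMap.det, ← LinearMap.det_toMatrix (EuclideanSpace.basisFun (Fin 3) ℝ).toBasis]
  congr 1

theorem frameDet_comp (p : ℂ × ℂ) (T : E3 →L[ℝ] ℂ × ℂ) (A : E3 →L[ℝ] E3) :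
    frameDet p (T.comp A) = A.det * frameDet p T := by
  have h : ∀ i, T.comp A (EuclideanSpace.single i 1) =
      A (EuclideanSpace.single i 1) 0 • T (EuclideanSpace.single 0 (1 : ℝ)) +
      A (EuclideanSpace.single i 1) 1 • T (EuclideanSpace.single 1 (1 : ℝ)) +
      A (EuclideanSpace.single i 1) 2 • T (EuclideanSpace.single 2 (1 : ℝ)) :=
    fun i => map_E3 (T : E3 →ₗ[ℝ] ℂ × ℂ) (A (EuclideanSpace.single i 1))
  simp only [frameDet, h, E3.det_eq, Matrix.det_fin_three, Matrix.of_apply, orientationDet_apply,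
    Prod.fst_add, Prod.snd_add, Prod.smul_fst, Prod.smul_snd, Complex.add_re, Complex.add_im,
    Complex.real_smul, Complex.re_ofReal_mul, Complex.im_ofReal_mul]
  ring

/-- A determinant is nonzero exactly if its rows are independent. One direction turns oriented
parametrizations into immersions, the other proves nonvanishing at the core of the surgery. -/
theorem frameDet_ne_zero_iff (p : ℂ × ℂ) (T : E3 →L[ℝ] ℂ × ℂ) :
    frameDet p T ≠ 0 ↔ ∀ (l : ℝ) (x : E3), l • p + T x = 0 → l = 0 ∧ x = 0 := by
  rw [frameDet, orientationDet, ne_eq, ← Matrix.exists_vecMul_eq_zero_iff]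
  set M : Matrix (Fin 4) (Fin 4) ℝ := Matrix.of ![realCoords p,
    realCoords (T (EuclideanSpace.single 0 1)), realCoords (T (EuclideanSpace.single 1 1)),
    realCoords (T (EuclideanSpace.single 2 1))] with hM
  have key : ∀ (l : ℝ) (x : E3), l • p + T x = 0 ↔
      Matrix.vecMul ![l, x 0, x 1, x 2] M = 0 := by
    intro l x
    have h := map_E3 (T : E3 →ₗ[ℝ] ℂ × ℂ) x
    simp only [ContinuousLinearMap.coe_coe] at h
    rw [h]
    simp only [hM, funext_iff, Matrix.vecMul, dotProduct, Fin.sum_univ_four, Fin.forall_fin_succ,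
      realCoords, Prod.ext_iff, Complex.ext_iff]
    simp [add_assoc]
    tauto
  constructor
  · intro h l x h0
    by_contra hne
    refine h ⟨_, fun hv => hne ?_, (key l x).1 h0⟩
    have e0 := congrFun hv 0
    have e1 := congrFun hv 1
    have e2 := congrFun hv 2
    have e3 := congrFun hv 3
    simp at e0 e1 e2 e3
    refine ⟨e0, ?_⟩
    ext i
    fin_cases i <;> simpa
  · rintro h ⟨v, hv, hv0⟩
    apply hv
    have hx := h (v 0) (WithLp.toLp 2 ![v 1, v 2, v 3]) (by
      rw [key]
      convert hv0 using 2
      ext i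
      fin_cases i <;> simp)
    have h1 := congrArg (fun x : E3 => x 0) hx.2
    have h2 := congrArg (fun x : E3 => x 1) hx.2
    have h3 := congrArg (fun x : E3 => x 2) hx.2
    simp at h1 h2 h3
    ext i
    fin_cases i <;> simp [hx.1, h1, h2, h3]

/-! ### Smooth factorizations through an immersion -/

/-- If `L` is a linear left inverse of the derivative of `φ'`, then `L ∘ φ'` is a local
diffeomorphism, and `τ` is its local inverse applied to `L ∘ φ`. In this way transition maps known
only to be continuous become smooth. -/
theorem contDiffAt_of_comp_immersion {φ φ' : E3 → ℂ × ℂ} {τ : E3 → E3} {y : E3}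
    (hφ : ContDiffAt ℝ ∞ φ y) (hφ' : ContDiffAt ℝ ∞ φ' (τ y)) (hτ : ContinuousAt τ y)
    (hinj : Function.Injective (fderiv ℝ φ' (τ y))) (heq : φ =ᶠ[𝓝 y] φ' ∘ τ) :
    ContDiffAt ℝ ∞ τ y := by
  obtain ⟨L, hL⟩ := LinearMap.exists_leftInverse_of_injective
    (fderiv ℝ φ' (τ y) : E3 →ₗ[ℝ] ℂ × ℂ) (LinearMap.ker_eq_bot.2 hinj)
  set L' : ℂ × ℂ →L[ℝ] E3 := L.toContinuousLinearMap
  have hd : HasFDerivAt (fun z => L' (φ' z))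
      ((ContinuousLinearEquiv.refl ℝ E3 : E3 ≃L[ℝ] E3) : E3 →L[ℝ] E3) (τ y) := by
    have h1 := L'.hasFDerivAt.comp (τ y) (hφ'.differentiableAt (by simp)).hasFDerivAt
    have h2 : L'.comp (fderiv ℝ φ' (τ y)) =
        ((ContinuousLinearEquiv.refl ℝ E3 : E3 ≃L[ℝ] E3) : E3 →L[ℝ] E3) :=
      ContinuousLinearMap.ext fun x => LinearMap.congr_fun hL x
    rwa [h2] at h1
  have hc : ContDiffAt ℝ ∞ (fun z => L' (φ' z)) (τ y) := L'.contDiff.contDiffAt.comp _ hφ'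
  have hg := hc.to_localInverse hd (by simp)
  have hev := (hc.hasStrictFDerivAt' hd (by simp)).eventually_left_inverse
  have h2 : τ =ᶠ[𝓝 y] fun z => hc.localInverse hd (by simp) (L' (φ z)) := by
    filter_upwards [hτ.eventually hev, heq] with z hz hz'
    rw [hz']
    exact hz.symm
  refine ContDiffAt.congr_of_eventuallyEq ?_ h2
  refine ContDiffAt.comp y ?_ (L'.contDiff.contDiffAt.comp _ hφ)
  have : L' (φ y) = L' (φ' (τ y)) := by rw [heq.self_of_nhds]; rfl
  rwa [← this] at hg

theorem paramDet_comp {φ φ' : E3 → ℂ × ℂ} {τ : E3 → E3} {y : E3}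
    (hφ' : DifferentiableAt ℝ φ' (τ y)) (hτ : DifferentiableAt ℝ τ y)
    (heq : φ =ᶠ[𝓝 y] φ' ∘ τ) :
    paramDet φ y = (fderiv ℝ τ y).det * paramDet φ' (τ y) := by
  rw [paramDet, paramDet, heq.fderiv_eq, fderiv_comp y hφ' hτ, frameDet_comp, heq.self_of_nhds]
  rfl

theorem injective_fderiv_of_paramDet_ne_zero {φ : E3 → ℂ × ℂ} {y : E3} (h : paramDet φ y ≠ 0) :
    Function.Injective (fderiv ℝ φ y) := by
  rw [injective_iff_map_eq_zero]
  intro x hx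
  exact ((frameDet_ne_zero_iff _ _).1 h 0 x (by simp [hx])).2

theorem continuousAt_paramDet {φ : E3 → ℂ × ℂ} {y : E3} (h : ContDiffAt ℝ ∞ φ y) :
    ContinuousAt (paramDet φ) y := by
  have h1 : ContinuousAt (fderiv ℝ φ) y := h.continuousAt_fderiv (by simp)
  have h0 := h.continuousAt
  have h2 : ∀ v, ContinuousAt (fun z => fderiv ℝ φ z v) y :=
    fun v => h1.clm_apply continuousAt_const
  have h3 := h2 (EuclideanSpace.single 0 1)
  have h4 := h2 (EuclideanSpace.single 1 1)
  have h5 := h2 (EuclideanSpace.single 2 1)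
  unfold paramDet frameDet
  simp only [orientationDet_apply]
  fun_prop

/-! ### Roots of unity -/

theorem isPrimitiveRoot_zeta {n : ℤ} (hn : n ≠ 0) : IsPrimitiveRoot (zeta n) n.natAbs := by
  have := Complex.isPrimitiveRoot_exp n.natAbs (by simpa using hn)
  rw [zeta]
  convert this using 5
  rw [← Int.natCast_natAbs, Int.cast_natCast]

theorem exists_zeta_pow_eq {n : ℤ} (hn : n ≠ 0) {c : ℂ} (hc : c ^ n = 1) :
    ∃ k < n.natAbs, zeta n ^ k = c := by
  have : NeZero n.natAbs := ⟨by simpa using hn⟩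
  refine (isPrimitiveRoot_zeta hn).eq_pow_of_pow_eq_one ?_
  rcases Int.natAbs_eq n with h | h
  · rwa [h, zpow_natCast] at hc
  · rwa [h, zpow_neg, zpow_natCast, inv_eq_one] at hc

theorem exists_zeta_zpow_eq {n : ℤ} (hn : n ≠ 0) {c : ℂ} (hc : c ^ n = 1) :
    ∃ k : ℤ, zeta n ^ k = c := by
  obtain ⟨k, -, h⟩ := exists_zeta_pow_eq hn hc
  exact ⟨k, by simpa using h⟩

theorem zeta_zpow_zpow {n : ℤ} (hn : n ≠ 0) (k : ℤ) : (zeta n ^ k) ^ n = 1 := by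
  have h := (isPrimitiveRoot_zeta hn).pow_eq_one
  have h1 : zeta n ^ n = 1 := by
    obtain ⟨k, hk⟩ : (n.natAbs : ℤ) ∣ n := Int.natAbs_dvd.2 dvd_rfl
    conv_lhs => rw [hk]
    rw [zpow_mul, zpow_natCast, ← hk, h, one_zpow]
  rw [← zpow_mul, mul_comm, zpow_mul, h1, one_zpow]

theorem norm_zeta_zpow {n : ℤ} (hn : n ≠ 0) (k : ℤ) : ‖zeta n ^ k‖ = 1 := by
  rw [norm_zpow, (isPrimitiveRoot_zeta hn).norm'_eq_one (by simpa using hn), one_zpow]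

theorem finite_range_zeta_zpow {n : ℤ} (hn : n ≠ 0) : (Set.range fun k :
    ℤ => zeta n ^ k).Finite := by
  refine ((Finset.range n.natAbs).finite_toSet.image fun k : ℕ => zeta n ^ k).subset ?_
  rintro _ ⟨k, rfl⟩
  obtain ⟨m, hm, h⟩ := exists_zeta_pow_eq hn (zeta_zpow_zpow hn k)
  exact ⟨m, by simpa using hm, h⟩

/-- The group is finite and acts freely on nonzero vectors: for each of the finitely many `c ≠ 1`,
the values of `ψ` and `c • φ` differ at `x`, hence near `x`. -/
theorem eventually_eq_of_orbit {n : ℤ} (hn : n ≠ 0) {X : Type*} [TopologicalSpace X]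
    {φ ψ : X → ℂ × ℂ} {x : X} (hφ : ContinuousAt φ x) (hψ : ContinuousAt ψ x) (h0 : ψ x = φ x)
    (hne : φ x ≠ 0) : ∀ᶠ y in 𝓝 x, (∃ k : ℤ, ψ y = zeta n ^ k • φ y) → ψ y = φ y := by
  have h1 : ∀ᶠ y in 𝓝 x, ∀ c ∈ Set.range (fun k : ℤ => zeta n ^ k), c ≠ 1 → ψ y ≠ c • φ y := by
    rw [(finite_range_zeta_zpow hn).eventually_all]
    intro c _
    by_cases hc : c = 1
    · simp [hc]
    · have h2 : ψ x ≠ c • φ x := by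
        rw [h0]
        intro h3
        have h4 : (1 - c) • φ x = 0 := by rw [sub_smul, one_smul, ← h3, sub_self]
        rcases smul_eq_zero.1 h4 with h5 | h5
        · exact hc (sub_eq_zero.1 h5).symm
        · exact hne h5
      filter_upwards [((hψ.ne_iff_eventually_ne (hφ.const_smul c)).1 h2)] with y hy _ using hy
  filter_upwards [h1] with y hy' ⟨k, hk⟩
  by_cases hc : zeta n ^ k = 1
  · rw [hk, hc, one_smul]
  · exact absurd hk (hy' _ ⟨k, rfl⟩ hc)

/-- Two lifts of the same map through the quotient by the roots of unity agree near a point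
where they take the same value. -/
theorem eventuallyEq_of_orbit {n : ℤ} (hn : n ≠ 0) {X : Type*} [TopologicalSpace X]
    {φ ψ : X → ℂ × ℂ} {x : X} (hφ : ContinuousAt φ x) (hψ : ContinuousAt ψ x) (h0 : ψ x = φ x)
    (hne : φ x ≠ 0) (h : ∀ᶠ y in 𝓝 x, ∃ k : ℤ, ψ y = zeta n ^ k • φ y) : ψ =ᶠ[𝓝 x] φ := by
  filter_upwards [h, eventually_eq_of_orbit hn hφ hψ h0 hne] with y hy hy' using hy' hy

/-! ### Normalization of vectors in `ℂ²` -/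

/-- The Euclidean norm on `ℂ²`. -/
def euclNorm (w : ℂ × ℂ) : ℝ := √(‖w.1‖ ^ 2 + ‖w.2‖ ^ 2)

theorem euclNorm_pos {w : ℂ × ℂ} (hw : w ≠ 0) : 0 < euclNorm w := by
  apply Real.sqrt_pos.2
  by_cases h : w.1 = 0
  · have h2 : w.2 ≠ 0 := fun h2 => hw (Prod.ext h h2)
    positivity
  · positivity

theorem mem_S3_iff {w : ℂ × ℂ} : w ∈ S3 ↔ euclNorm w = 1 := by
  rw [euclNorm, Real.sqrt_eq_one]
  rfl

theorem S3_ne_zero {w : ℂ × ℂ} (hw : w ∈ S3) : w ≠ 0 := by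
  rintro rfl
  simp [S3] at hw

theorem euclNorm_smul (c : ℂ) (w : ℂ × ℂ) : euclNorm (c • w) = ‖c‖ * euclNorm w := by
  simp only [euclNorm, Prod.smul_fst, Prod.smul_snd, smul_eq_mul, norm_mul, mul_pow, ← mul_add]
  rw [Real.sqrt_mul (by positivity), Real.sqrt_sq (norm_nonneg c)]

theorem euclNorm_real_smul (c : ℝ) (w : ℂ × ℂ) : euclNorm (c • w) = |c| * euclNorm w := by
  have := euclNorm_smul (c : ℂ) w
  rwa [Complex.norm_real, Real.norm_eq_abs, Complex.coe_smul] at this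

theorem smul_mem_S3 {c : ℂ} (hc : ‖c‖ = 1) {w : ℂ × ℂ} (hw : w ∈ S3) : c • w ∈ S3 := by
  rw [mem_S3_iff] at hw ⊢
  rw [euclNorm_smul, hc, hw, one_mul]

theorem inv_euclNorm_smul_mem {w : ℂ × ℂ} (hw : w ≠ 0) : (euclNorm w)⁻¹ • w ∈ S3 := by
  rw [mem_S3_iff, euclNorm_real_smul, abs_of_pos (inv_pos.2 (euclNorm_pos hw)),
    inv_mul_cancel₀ (euclNorm_pos hw).ne']

theorem contDiffAt_inv_euclNorm {w : ℂ × ℂ} (hw : w ≠ 0) :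
    ContDiffAt ℝ ∞ (fun w => (euclNorm w)⁻¹) w := by
  have h := euclNorm_pos hw
  refine ContDiffAt.inv ?_ h.ne'
  refine ContDiffAt.sqrt ?_ (Real.sqrt_pos.1 h).ne'
  exact ((contDiff_norm_sq ℝ).comp contDiff_fst).contDiffAt.add
    ((contDiff_norm_sq ℝ).comp contDiff_snd).contDiffAt

/-- This is the derivative of a product `c • w`: the terms `l x • w` are parallel to the first row
and drop out, so radial normalization does not affect the sign. -/
theorem frameDet_smul_add (c : ℝ) (l : E3 → ℝ) (w : ℂ × ℂ) (T : E3 → ℂ × ℂ) :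
    frameDet (c • w) (fun x => c • T x + l x • w) = c ^ 4 * frameDet w T := by
  simp only [frameDet, orientationDet_apply, Prod.fst_add, Prod.snd_add, Prod.smul_fst,
    Prod.smul_snd, Complex.add_re, Complex.add_im, Complex.real_smul, Complex.re_ofReal_mul,
    Complex.im_ofReal_mul]
  ring

theorem paramDet_real_smul {c : E3 → ℝ} {w : E3 → ℂ × ℂ} {y : E3} (hc : DifferentiableAt ℝ c y)
    (hw : DifferentiableAt ℝ w y) : paramDet (fun z => c z • w z) y = c y ^ 4 * paramDet w y := by
  rw [paramDet, fderiv_fun_smul hc hw, paramDet, ← frameDet_smul_add (c y) (fderiv ℝ c y)]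
  rfl

theorem paramDet_const_smul {c : ℂ} (hc : ‖c‖ = 1) {w : E3 → ℂ × ℂ} {y : E3}
    (hw : DifferentiableAt ℝ w y) : paramDet (fun z => c • w z) y = paramDet w y := by
  rw [paramDet, fderiv_fun_const_smul hw, paramDet, ← frameDet_smul hc (w y)]
  rfl

theorem isCompact_S3 : IsCompact S3 := by
  refine Metric.isCompact_of_isClosed_isBounded ?_ ?_
  · exact isClosed_eq (by fun_prop) continuous_const
  · refine (Metric.isBounded_closedBall (x := (0 : ℂ × ℂ)) (r := 1)).subset fun w hw => ?_
    have h : ‖w.1‖ ^ 2 + ‖w.2‖ ^ 2 = 1 := hw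
    rw [mem_closedBall_zero_iff, Prod.norm_def, sup_le_iff]
    constructor <;> nlinarith [norm_nonneg w.1, norm_nonneg w.2]

instance : CompactSpace S3 := isCompact_iff_compactSpace.1 isCompact_S3

theorem isConnected_S3 : IsConnected S3 := by
  have h : IsConnected ({0}ᶜ : Set (ℂ × ℂ)) := by
    refine isConnected_compl_singleton_of_one_lt_rank ?_ 0
    rw [rank_prod', Complex.rank_real_complex]
    norm_num
  have h2 : S3 = (fun w => (euclNorm w)⁻¹ • w) '' ({0}ᶜ : Set (ℂ × ℂ)) := by
    ext w
    constructor
    · intro hw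
      exact ⟨w, S3_ne_zero hw, by simp [mem_S3_iff.1 hw]⟩
    · rintro ⟨w, hw, rfl⟩
      exact inv_euclNorm_smul_mem hw
  rw [h2]
  refine h.image _ fun w hw => ?_
  exact ((contDiffAt_inv_euclNorm hw).continuousAt.smul continuousAt_id).continuousWithinAt

instance : ConnectedSpace S3 := isConnected_iff_connectedSpace.1 isConnected_S3

/-! ### Quotients of the sphere by the roots of unity -/

/-- `π` exhibits `M` as the quotient of the sphere by the `|n|`-th roots of unity. -/
structure IsLensQuotient {M : Type*} [TopologicalSpace M] (n : ℤ) (π : S3 → M) : Prop where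
  continuous : Continuous π
  isOpenMap : IsOpenMap π
  surjective : Function.Surjective π
  eq_iff : ∀ p q : S3, π p = π q ↔ ∃ k : ℤ, q.1 = zeta n ^ k • p.1

/-- The smooth charts of `M` that have the orientation of the sphere multiplied by the sign
of `σ`. -/
def orientedAtlas {M : Type*} [TopologicalSpace M] (π : S3 → M) (σ : ℝ) :
    Set (OpenPartialHomeomorph M E3) :=
  {e | ∀ p : S3, π p ∈ e.source →
    ∃ φ, IsSmoothLiftAt Subtype.val π e p φ ∧ 0 < σ * paramDet φ (e (π p))}

section

variable {M N : Type*} [TopologicalSpace M] [TopologicalSpace N] {n : ℤ} {π : S3 → M} {ρ : S3 → N}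

theorem IsLensQuotient.compactSpace (h : IsLensQuotient n π) : CompactSpace M := by
  have := isCompact_range h.continuous
  rw [h.surjective.range_eq] at this
  exact ⟨this⟩

theorem IsLensQuotient.connectedSpace (h : IsLensQuotient n π) : ConnectedSpace M :=
  h.surjective.connectedSpace h.continuous

/-- The quotient map is open, and the equivalence relation is closed as a finite union of graphs of
rotations. -/
theorem IsLensQuotient.t2Space (h : IsLensQuotient n π) (hn : n ≠ 0) : T2Space M := by
  rw [t2Space_iff_of_isOpenQuotientMap ⟨h.surjective, h.continuous, h.isOpenMap⟩]
  have : {q : S3 × S3 | π q.1 = π q.2} =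
      ⋃ c ∈ Set.range (fun k : ℤ => zeta n ^ k), {q : S3 × S3 | q.2.1 = c • q.1.1} := by
    ext q
    simp [h.eq_iff]
  rw [this]
  refine (finite_range_zeta_zpow hn).isClosed_biUnion fun c _ => ?_
  exact isClosed_eq (by fun_prop) (by fun_prop)

/-- A map under the identity of the sphere is smooth in the oriented charts, and the sign of its
Jacobian determinant is the product of the signs of the orientations. -/
theorem IsLensQuotient.contDiffAt_and_det_pos (hn : n ≠ 0) (hρ : IsLensQuotient n ρ)
    (hπ : IsLensQuotient n π) {f : M → N} (hf : Continuous f) (hfπ : ∀ q, f (π q) = ρ q)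
    {σ σ' : ℝ} {e : OpenPartialHomeomorph M E3} {e' : OpenPartialHomeomorph N E3}
    (he : e ∈ orientedAtlas π σ) (he' : e' ∈ orientedAtlas ρ σ') {y : E3} (hy : y ∈ e.target)
    (hy' : f (e.symm y) ∈ e'.source) :
    ContDiffAt ℝ ∞ (e' ∘ f ∘ e.symm) y ∧ 0 < σ * σ' * (fderiv ℝ (e' ∘ f ∘ e.symm) y).det := by
  obtain ⟨q, hq⟩ := hπ.surjective (e.symm y)
  have hey : e (π q) = y := by rw [hq, e.right_inv hy]
  have hρq : ρ q = f (e.symm y) := by rw [← hfπ, hq]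
  have hτy : e' (ρ q) = (e' ∘ f ∘ e.symm) y := by rw [hρq]; rfl
  obtain ⟨φ, ⟨hφ, hφq, hφl⟩, hφs⟩ := he q (by rw [hq]; exact e.map_target hy)
  obtain ⟨φ', ⟨hφ', hφq', hφl'⟩, hφs'⟩ := he' q (by rwa [hρq])
  rw [hey] at hφ hφq hφl hφs
  rw [hτy] at hφ' hφq' hφl' hφs'
  set τ := e' ∘ f ∘ e.symm with hτ
  have hes : ContinuousAt e.symm y := e.continuousAt_symm hy
  have hfs : ContinuousAt (f ∘ e.symm) y := hf.continuousAt.comp hes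
  have hτc : ContinuousAt τ y := ContinuousAt.comp (g := e') (f :=
    f ∘ e.symm) (e'.continuousAt hy') hfs
  -- Both sides lift the same map to the lens quotient `N` and agree at `y`, so they agree nearby.
  have heq : φ =ᶠ[𝓝 y] φ' ∘ τ := by
    refine eventuallyEq_of_orbit hn (hφ'.continuousAt.comp hτc) hφ.continuousAt
      (hφq.trans hφq'.symm) ?_ ?_
    · rw [Function.comp_apply, hφq']
      exact S3_ne_zero q.2
    · filter_upwards [hφl, hτc.eventually hφl', hfs.eventually (e'.open_source.mem_nhds hy')] with
        z ⟨x, hx, hxz⟩ ⟨x', hx', hxz'⟩ hz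
      have h1 : ρ x' = ρ x := by
        rw [hxz', ← hfπ, hxz]
        exact e'.left_inv hz
      obtain ⟨k, hk⟩ := (hρ.eq_iff _ _).1 h1
      exact ⟨k, by rw [← hx, hk, hx']; rfl⟩
  have hne' : paramDet φ' (τ y) ≠ 0 := fun h => by simp [h] at hφs'
  have hτd := contDiffAt_of_comp_immersion hφ hφ' hτc
    (injective_fderiv_of_paramDet_ne_zero hne') heq
  refine ⟨hτd, ?_⟩
  have hdet := paramDet_comp (hφ'.differentiableAt (by simp)) (hτd.differentiableAt (by simp)) heq
  -- After substituting `hdet`, this product is `σ * σ' * det` times the square of `paramDet φ' (τ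
  -- y)`.
  have h2 := mul_pos hφs hφs'
  rw [hdet] at h2
  have h3 : 0 < paramDet φ' (τ y) ^ 2 := by positivity
  exact pos_of_mul_pos_left (b := paramDet φ' (τ y) ^ 2) (by linarith) h3.le

/-- A linear frame of `ℂ²` with first vector `p` and determinant `σ`. -/
theorem exists_frame {p : ℂ × ℂ} (hp : p ∈ S3) (σ : ℝ) :
    ∃ T : E3 →L[ℝ] ℂ × ℂ, frameDet p T = σ := by
  let T : E3 →ₗ[ℝ] ℂ × ℂ :=
    { toFun := fun x => (((x 0 : ℝ) : ℂ) * (Complex.I * p.1) - ((x 1 : ℝ) : ℂ) * star p.2 -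
          ((σ * x 2 : ℝ) : ℂ) * (Complex.I * star p.2),
        ((x 0 : ℝ) : ℂ) * (Complex.I * p.2) + ((x 1 : ℝ) : ℂ) * star p.1 +
          ((σ * x 2 : ℝ) : ℂ) * (Complex.I * star p.1))
      map_add' := fun x y => by
        ext1 <;> simp <;> ring
      map_smul' := fun c x => by
        ext1 <;> simp <;> ring }
  refine ⟨T.toContinuousLinearMap, ?_⟩
  have h : ‖p.1‖ ^ 2 + ‖p.2‖ ^ 2 = 1 := hp
  simp only [← Complex.normSq_eq_norm_sq, Complex.normSq_apply] at h
  have hT : ∀ x, T.toContinuousLinearMap x = (((x 0 : ℝ) : ℂ) * (Complex.I * p.1) -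
      ((x 1 : ℝ) : ℂ) * star p.2 - ((σ * x 2 : ℝ) : ℂ) * (Complex.I * star p.2),
        ((x 0 : ℝ) : ℂ) * (Complex.I * p.2) + ((x 1 : ℝ) : ℂ) * star p.1 +
          ((σ * x 2 : ℝ) : ℂ) * (Complex.I * star p.1)) := fun x => rfl
  simp only [frameDet, orientationDet_apply, hT]
  simp
  -- The vectors `p`, `ip`, `(-p̄₂, p̄₁)` and its multiple by `i` are orthogonal of equal length, so
  -- the determinant is `σ |p|⁴`. The coefficient comes from `|p|⁴ - 1 = (|p|² + 1)(|p|² - 1)`.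
  linear_combination σ * (p.1.re * p.1.re + p.1.im * p.1.im + (p.2.re * p.2.re + p.2.im * p.2.im)
    + 1) * h

/-- The inverse chart is central projection: the affine hyperplane `p + T y` is normalized onto an
open hemisphere and then mapped by `π`. The scaling built into `T` gives the orientation `σ`. -/
theorem IsLensQuotient.exists_chart (h : IsLensQuotient n π) (hn : n ≠ 0) {σ : ℝ} (hσ : σ ≠ 0)
    (p : S3) : ∃ e ∈ orientedAtlas π σ, π p ∈ e.source := by
  obtain ⟨T, hT⟩ := exists_frame p.2 σ
  have hT' := (frameDet_ne_zero_iff p.1 T).1 (hT ▸ hσ)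
  let L : (ℝ × E3) →L[ℝ] ℂ × ℂ :=
    ((ContinuousLinearMap.id ℝ ℝ).smulRight p.1).coprod T
  have hL : ∀ l x, L (l, x) = l • p.1 + T x := fun l x => rfl
  have hLinj : Function.Injective (L : (ℝ × E3) →ₗ[ℝ] ℂ × ℂ) := by
    rw [injective_iff_map_eq_zero]
    rintro ⟨l, x⟩ hx
    have := hT' l x hx
    exact Prod.ext this.1 this.2
  let Λ : (ℝ × E3) ≃L[ℝ] ℂ × ℂ := (LinearEquiv.ofInjectiveOfFinrankEq
    (L : (ℝ × E3) →ₗ[ℝ] ℂ × ℂ) hLinj (by simp)).toContinuousLinearEquiv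
  have hΛ : ∀ l x, Λ (l, x) = l • p.1 + T x := fun l x => rfl
  let w : E3 → ℂ × ℂ := fun y => p.1 + T y
  have hwΛ : ∀ y, w y = Λ (1, y) := fun y => by rw [hΛ, one_smul]
  have hw : ∀ y, w y ≠ 0 := fun y hy => by
    rw [hwΛ, Λ.map_eq_zero_iff] at hy
    simpa using congrArg Prod.fst hy
  have hwd : ContDiff ℝ ∞ w := contDiff_const.add T.contDiff
  let P : E3 → S3 := fun y => ⟨(euclNorm (w y))⁻¹ • w y, inv_euclNorm_smul_mem (hw y)⟩
  have hcd : ∀ y, ContDiffAt ℝ ∞ (fun z => (euclNorm (w z))⁻¹) y := fun y =>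
    (contDiffAt_inv_euclNorm (hw y)).comp y hwd.contDiffAt
  have hPd : ∀ y, ContDiffAt ℝ ∞ (fun z => (P z : ℂ × ℂ)) y := fun y =>
    (hcd y).smul hwd.contDiffAt
  have hPc : Continuous P := by
    refine Continuous.subtype_mk ?_ _
    exact continuous_iff_continuousAt.2 fun y => (hPd y).continuousAt
  have hPdet : ∀ y, paramDet (fun z => (P z : ℂ × ℂ)) y = (euclNorm (w y))⁻¹ ^ 4 * σ := by
    intro y
    have h1 := paramDet_real_smul ((hcd y).differentiableAt (by simp))
      (hwd.contDiffAt.differentiableAt (x := y) (by simp))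
    have h2 : fderiv ℝ w y = T := by
      change fderiv ℝ (fun y => p.1 + T y) y = T
      rw [fderiv_const_add]
      exact T.fderiv
    have h3 : paramDet w y = σ := by
      rw [paramDet, h2, ← hT, ← one_mul (frameDet (p : ℂ × ℂ) T)]
      have h4 := map_E3 (T : E3 →ₗ[ℝ] ℂ × ℂ) y
      simp only [ContinuousLinearMap.coe_coe] at h4
      have h5 : w y = p.1 + T y := rfl
      rw [h5, h4]
      simp only [frameDet, orientationDet_apply, Prod.fst_add, Prod.snd_add, Prod.smul_fst,
        Prod.smul_snd, Complex.add_re, Complex.add_im, Complex.real_smul, Complex.re_ofReal_mul,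
        Complex.im_ofReal_mul]
      ring
    rw [← h3]
    exact h1
  have hΛP : ∀ y, Λ.symm (P y).1 = ((euclNorm (w y))⁻¹, (euclNorm (w y))⁻¹ • y) := fun y => by
    rw [ContinuousLinearEquiv.symm_apply_eq]
    change (euclNorm (w y))⁻¹ • w y = _
    rw [hwΛ y, ← map_smul]
    simp
  have hPo : IsOpenMap P := by
    intro U hU
    have hl : Continuous fun q : S3 => (Λ.symm q.1).1 := by fun_prop
    have hx : Continuous fun q : S3 => (Λ.symm q.1).2 := by fun_prop
    -- In the linear coordinates `Λ`, the ray through `P y` is that of `(1, y)`; thus `y` is the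
    -- quotient of the two coordinates, wherever the first is positive.
    have himg : P '' U = {q : S3 | 0 < (Λ.symm q.1).1} ∩
        (fun q : S3 => ((Λ.symm q.1).1)⁻¹ • (Λ.symm q.1).2) ⁻¹' U := by
      ext q
      constructor
      · rintro ⟨y, hy, rfl⟩
        have h1 := hΛP y
        have h2 := euclNorm_pos (hw y)
        constructor
        · simp only [Set.mem_ofPred_eq, h1]
          positivity
        · simp only [Set.mem_preimage, h1]
          rwa [smul_smul, inv_mul_cancel₀ (by positivity), one_smul]
      · rintro ⟨hq, hqU⟩
        refine ⟨_, hqU, Subtype.ext ?_⟩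
        simp only [Set.mem_ofPred_eq] at hq
        have h1 : w ((Λ.symm q.1).1⁻¹ • (Λ.symm q.1).2) = (Λ.symm q.1).1⁻¹ • q.1 := by
          rw [hwΛ, eq_comm, ← Λ.symm_apply_eq, map_smul]
          exact Prod.ext (inv_mul_cancel₀ hq.ne') rfl
        change (euclNorm (w _))⁻¹ • w _ = _
        rw [h1, euclNorm_real_smul, mem_S3_iff.1 q.2, abs_of_pos (inv_pos.2 hq), mul_one, inv_inv,
          smul_smul, mul_inv_cancel₀ hq.ne', one_smul]
    rw [himg]
    have hop : IsOpen {q : S3 | 0 < (Λ.symm q.1).1} := isOpen_lt continuous_const hl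
    refine ContinuousOn.isOpen_inter_preimage ?_ hop hU
    exact (hl.continuousOn.inv₀ fun q hq => (show 0 < (Λ.symm q.1).1 from hq).ne').smul hx.continuousOn
  have hP0 : P 0 = p := by
    apply Subtype.ext
    change (euclNorm (p.1 + T 0))⁻¹ • (p.1 + T 0) = _
    rw [map_zero, add_zero, mem_S3_iff.1 p.2, inv_one, one_smul]
  -- Applied to the two projections of `E3 × E3`, local uniqueness of lifts says that `π ∘ P` is
  -- injective near `0`.
  have hev := eventually_eq_of_orbit hn (X := E3 × E3) (x := ((0 : E3), (0 : E3)))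
    (φ := fun z => (P z.1).1) (ψ := fun z => (P z.2).1)
    (by fun_prop) (by fun_prop) rfl (S3_ne_zero (P 0).2)
  rw [nhds_prod_eq] at hev
  obtain ⟨U₀, hU₀, hinj₀⟩ := Filter.eventually_prod_self_iff'.1 hev
  let U := interior U₀
  have h0U : (0 : E3) ∈ U := mem_interior_iff_mem_nhds.2 hU₀
  let f : E3 → M := fun y => π (P y)
  have hfinj : Set.InjOn f U := by
    intro y hy z hz hyz
    have h1 := hinj₀ y (interior_subset hy) z (interior_subset hz) ((h.eq_iff _ _).1 hyz)
    have h2 := congrArg Λ.symm h1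
    simp only [hΛP, Prod.mk.injEq] at h2
    rw [h2.1] at h2
    exact (smul_right_injective E3 (inv_pos.2 (euclNorm_pos (hw y))).ne' h2.2).symm
  have hfc : Continuous f := h.continuous.comp hPc
  let e₀ := OpenPartialHomeomorph.ofContinuousOpen (hfinj.toPartialEquiv f U) hfc.continuousOn
    (h.isOpenMap.comp hPo) isOpen_interior
  have he₀ : ∀ z, e₀ z = f z := fun z => rfl
  have hs : e₀.source = U := rfl
  have ht : e₀.target = f '' U := rfl
  refine ⟨e₀.symm, ?_, ?_⟩
  · intro q hq
    obtain ⟨y, hyU, hy⟩ : π q ∈ f '' U := hq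
    obtain ⟨k, hk⟩ := (h.eq_iff _ _).1 hy
    have hey : e₀.symm (π q) = y := by
      rw [← hy]
      exact e₀.left_inv hyU
    have hck := norm_zeta_zpow hn k
    -- The chart must lift through every point `q` of the fibre; a rotation by a root of unity moves
    -- `P` there.
    refine ⟨fun z => zeta n ^ k • (P z).1, ⟨?_, ?_, ?_⟩, ?_⟩
    · exact (hPd _).const_smul (zeta n ^ k)
    · rw [hey, hk]
    · refine Filter.Eventually.of_forall fun z => ⟨⟨_, smul_mem_S3 hck (P z).2⟩, rfl, ?_⟩
      exact ((h.eq_iff _ _).2 ⟨k, rfl⟩).symm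
    · rw [paramDet_const_smul hck ((hPd _).differentiableAt (by simp)), hPdet]
      have := euclNorm_pos (hw (e₀.symm (π q)))
      have h4 : 0 < (euclNorm (w (e₀.symm (π q))))⁻¹ ^ 4 * σ ^ 2 := by positivity
      linarith
  · refine ⟨0, h0U, ?_⟩
    change π (P 0) = π p
    rw [hP0]

theorem IsLensQuotient.isClosedOrientedManifold (h : IsLensQuotient n π) (hn : n ≠ 0) {σ : ℝ}
    (hσ : σ ≠ 0) : IsClosedOrientedManifold (orientedAtlas π σ) where
  compact := h.compactSpace
  hausdorff := h.t2Space hn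
  connected := h.connectedSpace
  cover x := by
    obtain ⟨p, rfl⟩ := h.surjective x
    exact h.exists_chart hn hσ p
  smooth e he e' he' y hy := by
    rw [OpenPartialHomeomorph.trans_source] at hy
    exact (h.contDiffAt_and_det_pos hn h continuous_id (fun _ => rfl) he he' hy.1
      hy.2).1.contDiffWithinAt
  oriented e he e' he' y hy := by
    rw [OpenPartialHomeomorph.trans_source] at hy
    have := (h.contDiffAt_and_det_pos hn h continuous_id (fun _ => rfl) he he' hy.1 hy.2).2
    have h2 : 0 < σ * σ := mul_self_pos.2 hσ
    exact pos_of_mul_pos_right this h2.le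

end

/-! ### The degree of a homeomorphism covered by the identity of the sphere -/

section

variable {M N : Type*} [TopologicalSpace M] [TopologicalSpace N] {n : ℤ} {π : S3 → M} {ρ : S3 → N}

theorem hasDegree_of_lift (hn : n ≠ 0) (hπ : IsLensQuotient n π) (hρ : IsLensQuotient n ρ)
    (Φ : M ≃ₜ N) (hΦ : ∀ q, Φ (π q) = ρ q) {σ : ℝ} {d : ℤ}
    (hσ : d = 1 ∧ 0 < σ ∨ d = -1 ∧ σ < 0) :
    HasDegree (orientedAtlas π σ) (orientedAtlas ρ 1) ⟨Φ, Φ.continuous⟩ d := by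
  have hσ0 : σ ≠ 0 := by 
    rcases hσ with h | h
    exacts [h.2.ne', h.2.ne]
  have key : ∀ e ∈ orientedAtlas π σ, ∀ e' ∈ orientedAtlas ρ 1, ∀ x ∈ e.source,
      Φ x ∈ e'.source → 0 < σ * jacobian e e' ⟨Φ, Φ.continuous⟩ x := by
    intro e he e' he' x hx hx'
    have := (hρ.contDiffAt_and_det_pos hn hπ Φ.continuous hΦ he he' (e.map_source hx)
      (by rwa [e.left_inv hx])).2
    rwa [mul_one] at this
  have hreg : ∀ y, IsRegularValue (orientedAtlas π σ) (orientedAtlas ρ 1) ⟨Φ, Φ.continuous⟩ y := by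
    intro y x hxy e he e' he' hx hy h0
    have := key e he e' he' x hx (by rwa [← hxy] at hy)
    simp [h0] at this
  have hsign : ∀ x, localSign (orientedAtlas π σ) (orientedAtlas ρ 1) ⟨Φ, Φ.continuous⟩ x = d := by
    intro x
    obtain ⟨p, rfl⟩ := hπ.surjective x
    obtain ⟨e, he, hx⟩ := hπ.exists_chart hn hσ0 p
    obtain ⟨e', he', hx'⟩ := hρ.exists_chart hn one_ne_zero p
    rw [← hΦ] at hx'
    rcases hσ with ⟨rfl, h⟩ | ⟨rfl, h⟩
    · rw [localSign, if_pos]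
      exact ⟨e, he, e', he', hx, hx', pos_of_mul_pos_right (key e he e' he' _ hx hx') h.le⟩
    · rw [localSign, if_neg, if_pos]
      · exact ⟨e, he, e', he', hx, hx', by nlinarith [key e he e' he' _ hx hx']⟩
      · rintro ⟨f, hf, f', hf', h1, h2, h3⟩
        nlinarith [key f hf f' hf' _ h1 h2]
  -- The homeomorphism is itself smooth in these charts and all its values are regular, so no
  -- homotopy is needed.
  refine ⟨⟨Φ, Φ.continuous⟩, .refl _, ?_, ?_, ?_⟩
  · intro e he e' he' y hy
    exact (hρ.contDiffAt_and_det_pos hn hπ Φ.continuous hΦ he he' hy.1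
      hy.2).1.contDiffWithinAt
  · obtain ⟨q⟩ := (inferInstance : Nonempty S3)
    exact ⟨ρ q, hreg _⟩
  · intro y _
    have h1 : (⟨Φ, Φ.continuous⟩ : C(M, N)) ⁻¹' {y} = {Φ.symm y} := by
      ext x
      simp [Homeomorph.eq_symm_apply]
    rw [h1, finsum_mem_singleton, hsign]

end

/-! ### Unit complex numbers and branches of roots -/

/-- `z / |z|`. -/
def direction (z : ℂ) : ℂ := z / (‖z‖ : ℂ)

theorem norm_direction {z : ℂ} (hz : z ≠ 0) : ‖direction z‖ = 1 := by
  simp [direction, hz]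

theorem direction_ne_zero {z : ℂ} (hz : z ≠ 0) : direction z ≠ 0 := by
  simp [direction, hz]

theorem norm_mul_direction (z : ℂ) : (‖z‖ : ℂ) * direction z = z := by
  by_cases hz : z = 0
  · simp [hz]
  · rw [direction]
    have : (‖z‖ : ℂ) ≠ 0 := by simpa using hz
    field_simp

theorem direction_mul (z w : ℂ) : direction (z * w) = direction z * direction w := by
  simp [direction, mul_div_mul_comm]

theorem direction_eq_self {z : ℂ} (hz : ‖z‖ = 1) : direction z = z := by simp [direction, hz]

theorem direction_ofReal {r : ℝ} (hr : 0 < r) : direction (r : ℂ) = 1 := by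
  have : (r : ℂ) ≠ 0 := by exact_mod_cast hr.ne'
  simp [direction, abs_of_pos hr, this]

theorem contDiffAt_ofReal_norm {z : ℂ} (hz : z ≠ 0) : ContDiffAt ℝ ∞ (fun z : ℂ => (‖z‖ : ℂ)) z :=
  Complex.ofRealCLM.contDiff.contDiffAt.comp z (contDiffAt_norm ℝ hz)

theorem contDiffAt_direction {z : ℂ} (hz : z ≠ 0) : ContDiffAt ℝ ∞ direction z := by
  have h := (contDiffAt_ofReal_norm hz).inv (by simpa using hz)
  exact contDiffAt_id.mul h

theorem contDiffAt_zpow_real (n : ℤ) {z : ℂ} (hz : z ≠ 0) : ContDiffAt ℝ ∞ (fun z : ℂ => z ^ n) z :=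
  ((analyticAt_id.zpow hz : AnalyticAt ℂ (fun z : ℂ => z ^ n) z).contDiffAt).restrict_scalars ℝ

theorem norm_eq_one_of_zpow {n : ℤ} (hn : n ≠ 0) {c : ℂ} (hc : ‖c ^ n‖ = 1) : ‖c‖ = 1 := by
  rw [norm_zpow] at hc
  by_contra h
  exact hn ((zpow_eq_one_iff_right₀ (norm_nonneg c) h).1 hc)

/-- A branch of `x ↦ x ^ (-1 / n)` on the unit circle near `b ^ (-n)`, with the value `b` there. -/
def branch (n : ℤ) (b x : ℂ) : ℂ := b * (x * b ^ n) ^ (-1 / (n : ℂ))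

theorem branch_zpow {n : ℤ} (hn : n ≠ 0) {b x : ℂ} (hb : b ≠ 0) : branch n b x ^ n = x⁻¹ := by
  have hn' : (n : ℂ) ≠ 0 := by exact_mod_cast hn
  rw [branch, mul_zpow, ← Complex.cpow_mul_int, div_mul_cancel₀ _ hn', Complex.cpow_neg_one,
    mul_inv, mul_left_comm, mul_inv_cancel₀ (zpow_ne_zero n hb), mul_one]

theorem norm_branch {n : ℤ} (hn : n ≠ 0) {b x : ℂ} (hb : b ≠ 0) (hx : ‖x‖ = 1) :
    ‖branch n b x‖ = 1 :=
  norm_eq_one_of_zpow hn (by rw [branch_zpow hn hb, norm_inv, hx, inv_one])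

theorem branch_self {n : ℤ} {b x : ℂ} (hx : b ^ n = x⁻¹) (hx0 : x ≠ 0) :
    branch n b x = b := by
  rw [branch, hx, mul_inv_cancel₀ hx0, Complex.one_cpow, mul_one]

/-- At `x` the argument `x * b ^ n` of the principal power is `1`, far from the cut, whatever root
`b` was chosen. -/
theorem contDiffAt_branch {n : ℤ} {b x : ℂ} (hx : b ^ n = x⁻¹) (hx0 : x ≠ 0) :
    ContDiffAt ℝ ∞ (branch n b) x := by
  have h : AnalyticAt ℂ (branch n b) x := by
    refine analyticAt_const.mul (AnalyticAt.cpow (analyticAt_id.mul analyticAt_const)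
      analyticAt_const ?_)
    simp only [hx, mul_inv_cancel₀ hx0]
    exact Complex.one_mem_slitPlane
  exact h.contDiffAt.restrict_scalars ℝ

theorem exists_zpow_eq_inv {n : ℤ} (hn : n ≠ 0) {x : ℂ} (hx : ‖x‖ = 1) :
    ∃ b : ℂ, ‖b‖ = 1 ∧ b ^ n = x⁻¹ :=
  ⟨branch n 1 x, norm_branch hn one_ne_zero hx, branch_zpow hn one_ne_zero⟩

/-! ### The lens space as a quotient -/

theorem isLensQuotient_mk {n : ℤ} (hn : n ≠ 0) : IsLensQuotient n (Quotient.mk (lensSetoid n)) where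
  continuous := continuous_quotient_mk'
  isOpenMap U hU := by
    have h : ∀ k : ℤ, Continuous fun q : S3 =>
        (⟨zeta n ^ k • q.1, smul_mem_S3 (norm_zeta_zpow hn k) q.2⟩ : S3) := fun k => by fun_prop
    have : Quotient.mk (lensSetoid n) ⁻¹' (Quotient.mk (lensSetoid n) '' U) =
        ⋃ k : ℤ, (fun q : S3 =>
          (⟨zeta n ^ k • q.1, smul_mem_S3 (norm_zeta_zpow hn k) q.2⟩ : S3)) ⁻¹' U := by
      ext q
      simp only [Set.mem_preimage, Set.mem_image, Set.mem_iUnion]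
      constructor
      · rintro ⟨p, hp, hpq⟩
        obtain ⟨k, hk⟩ := (lensSetoid n).symm (Quotient.exact hpq)
        exact ⟨k, by convert hp; exact hk.symm⟩
      · rintro ⟨k, hk⟩
        exact ⟨_, hk, Quotient.sound ((lensSetoid n).symm ⟨k, rfl⟩)⟩
    rw [isOpen_coinduced (f := Quotient.mk (lensSetoid n)), this]
    exact isOpen_iUnion fun k => hU.preimage (h k)
  surjective := Quotient.mk_surjective
  eq_iff _ _ := Quotient.eq

/-- The quotient `c' / c` is an `n`-th root of unity. This is what makes every choice of root
irrelevant in the lens space. -/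
theorem mk_eq_of_zpow_eq {n : ℤ} (hn : n ≠ 0) {c c' : ℂ} {q q' : S3} {x : ℂ × ℂ}
    (hq : q.1 = c • x) (hq' : q'.1 = c' • x) (hc : c ^ n = c' ^ n) (hc0 : c ≠ 0) :
    Quotient.mk (lensSetoid n) q = Quotient.mk (lensSetoid n) q' := by
  obtain ⟨k, hk⟩ := exists_zeta_zpow_eq hn (c := c' / c) (by
    rw [div_zpow, hc, div_self]
    exact hc ▸ zpow_ne_zero n hc0)
  refine Quotient.sound ⟨k, ?_⟩
  rw [hk, hq, hq', smul_smul, div_mul_cancel₀ _ hc0]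

/-! ### The map `i_n` and its inverse -/

/-- A local lift of `i_n`. -/
def rootLift (n : ℤ) (b : ℂ) (p : ℂ × ℂ) : ℂ × ℂ :=
  branch n b (direction p.2) • (p.1, (‖p.2‖ : ℂ))

/-- The inverse of `i_n`, lifted to the sphere. -/
def rootInv (n : ℤ) (q : ℂ × ℂ) : ℂ × ℂ :=
  (q.1 * (direction q.2)⁻¹, ‖q.2‖ * direction q.2 ^ (-n))

theorem rootMap_eq (n : ℤ) (p : ↥(S3 \ unknot)) : (rootMap n p).1 = rootLift n 1 p.1 := by
  simp [rootMap, rootLift, branch, direction]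

theorem iMap_eq {n : ℤ} (hn : n ≠ 0) {p : ↥(S3 \ unknot)} {c : ℂ} {q : S3}
    (hc : c ^ n = (direction p.1.2)⁻¹) (hq : q.1 = c • (p.1.1, (‖p.1.2‖ : ℂ))) :
    Quotient.mk (lensSetoid n) q = iMap n p := by
  have hd := direction_ne_zero (snd_ne_zero p)
  refine mk_eq_of_zpow_eq hn hq (rootMap_eq n p) ?_ ?_
  · rw [hc, branch_zpow hn one_ne_zero]
  · rintro rfl
    rw [zero_zpow n hn] at hc
    exact inv_ne_zero hd hc.symm

theorem norm_snd_mem_S3 {p : ℂ × ℂ} (hp : p ∈ S3) : (p.1, (‖p.2‖ : ℂ)) ∈ S3 := by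
  simpa [S3] using hp

theorem rootLift_mem_S3 {n : ℤ} (hn : n ≠ 0) {b : ℂ} (hb : b ≠ 0) {p : ℂ × ℂ} (hp : p ∈ S3)
    (hp2 : p.2 ≠ 0) : rootLift n b p ∈ S3 :=
  smul_mem_S3 (norm_branch hn hb (norm_direction hp2)) (norm_snd_mem_S3 hp)

theorem norm_rootLift_fst {n : ℤ} (hn : n ≠ 0) {b : ℂ} (hb : b ≠ 0) {p : ℂ × ℂ} (hp : p.2 ≠ 0) :
    ‖(rootLift n b p).1‖ = ‖p.1‖ := by
  simp [rootLift, norm_branch hn hb (norm_direction hp)]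

theorem norm_rootLift_snd {n : ℤ} (hn : n ≠ 0) {b : ℂ} (hb : b ≠ 0) {p : ℂ × ℂ} (hp : p.2 ≠ 0) :
    ‖(rootLift n b p).2‖ = ‖p.2‖ := by
  simp [rootLift, norm_branch hn hb (norm_direction hp)]

theorem mk_rootLift {n : ℤ} (hn : n ≠ 0) {b : ℂ} (hb : b ≠ 0) (p : ↥(S3 \ unknot)) :
    Quotient.mk (lensSetoid n) ⟨rootLift n b p.1, rootLift_mem_S3 hn hb p.2.1 (snd_ne_zero p)⟩ =
      iMap n p :=
  iMap_eq hn (branch_zpow hn hb) rfl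

theorem not_mem_unknot {p : ℂ × ℂ} (h : p.2 ≠ 0) : p ∉ unknot := by
  rintro ⟨z, rfl⟩
  exact h rfl

/-- The phase `c` cancels in the first coordinate and enters the second only through `c ^ (-n)`, so
`rootInv` is constant on orbits of roots of unity. -/
theorem rootInv_smul (n : ℤ) {c : ℂ} (hc : ‖c‖ = 1) (q : ℂ × ℂ) :
    rootInv n (c • q) = (q.1 * (direction q.2)⁻¹, ‖q.2‖ * (c ^ (-n) * direction q.2 ^ (-n))) := by
  have hc0 : c ≠ 0 := norm_ne_zero_iff.1 (by simp [hc])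
  simp only [rootInv, Prod.smul_fst, Prod.smul_snd, smul_eq_mul, direction_mul, norm_mul, hc,
    direction_eq_self hc, one_mul, mul_zpow]
  congr 1
  field_simp

theorem rootInv_root_smul {n : ℤ} (hn : n ≠ 0) {p : ℂ × ℂ} {c : ℂ} (hp : p.2 ≠ 0)
    (hc : c ^ n = (direction p.2)⁻¹) : rootInv n (c • (p.1, (‖p.2‖ : ℂ))) = p := by
  have hc1 : ‖c‖ = 1 := norm_eq_one_of_zpow hn (by rw [hc, norm_inv, norm_direction hp, inv_one])
  rw [rootInv_smul n hc1]
  have : direction (‖p.2‖ : ℂ) = 1 := direction_ofReal (norm_pos_iff.2 hp)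
  simp only [this, inv_one, mul_one, one_zpow, zpow_neg, hc, inv_inv, Complex.norm_real, norm_norm,
    norm_mul_direction]

theorem rootInv_rootLift {n : ℤ} (hn : n ≠ 0) {b : ℂ} (hb : b ≠ 0) {p : ℂ × ℂ} (hp : p.2 ≠ 0) :
    rootInv n (rootLift n b p) = p :=
  rootInv_root_smul hn hp (branch_zpow hn hb)

theorem rootInv_eq_of_mk_eq {n : ℤ} (hn : n ≠ 0) {q q' : S3}
    (h : Quotient.mk (lensSetoid n) q = Quotient.mk (lensSetoid n) q') :
    rootInv n q = rootInv n q' := by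
  obtain ⟨k, hk⟩ := Quotient.exact h
  rw [hk, rootInv_smul n (norm_zeta_zpow hn k), zpow_neg (zeta n ^ k), zeta_zpow_zpow hn, inv_one,
    one_mul]
  rfl

theorem norm_rootInv_fst {n : ℤ} {q : ℂ × ℂ} (hq : q.2 ≠ 0) : ‖(rootInv n q).1‖ = ‖q.1‖ := by
  simp [rootInv, norm_direction hq]

theorem norm_rootInv_snd {n : ℤ} {q : ℂ × ℂ} (hq : q.2 ≠ 0) : ‖(rootInv n q).2‖ = ‖q.2‖ := by
  simp [rootInv, norm_direction hq]

theorem rootInv_mem {n : ℤ} {q : ℂ × ℂ} (hq : q ∈ S3) (hq2 : q.2 ≠ 0) :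
    rootInv n q ∈ S3 \ unknot := by
  constructor
  · change ‖_‖ ^ 2 + ‖_‖ ^ 2 = 1
    rw [norm_rootInv_fst hq2, norm_rootInv_snd hq2]
    exact hq
  · refine not_mem_unknot (norm_ne_zero_iff.1 ?_)
    rw [norm_rootInv_snd hq2]
    exact norm_ne_zero_iff.2 hq2

theorem iMap_rootInv {n : ℤ} (hn : n ≠ 0) (q : S3) (hq : q.1.2 ≠ 0) :
    iMap n ⟨rootInv n q, rootInv_mem q.2 hq⟩ = Quotient.mk (lensSetoid n) q := by
  have hd := norm_direction hq
  have h0 := norm_pos_iff.2 hq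
  symm
  -- The root that belongs to `rootInv n q` is the phase of `q.2`, since `q = β • (q.1 β⁻¹, |q.2|)`
  -- for that phase `β`.
  refine iMap_eq hn (c := direction q.1.2) ?_ ?_
  · change _ = (direction (rootInv n q).2)⁻¹
    rw [rootInv, direction_mul, direction_ofReal h0, one_mul, direction_eq_self (z :=
      direction q.1.2 ^ (-n))
      (by rw [norm_zpow, hd, one_zpow]),
      zpow_neg, inv_inv]
  · change _ = direction q.1.2 • ((rootInv n q).1, (‖(rootInv n q).2‖ : ℂ))
    rw [norm_rootInv_snd hq]
    have := direction_ne_zero hq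
    refine Prod.ext ?_ ?_
    · simp only [rootInv, Prod.smul_fst, smul_eq_mul]
      field_simp
    · simp only [Prod.smul_snd, smul_eq_mul]
      rw [mul_comm, norm_mul_direction]

theorem iMap_injective {n : ℤ} (hn : n ≠ 0) : Function.Injective (iMap n) := by
  intro p p' h
  have h1 := rootInv_eq_of_mk_eq hn h
  rw [rootMap_eq, rootMap_eq, rootInv_rootLift hn one_ne_zero (snd_ne_zero p),
    rootInv_rootLift hn one_ne_zero (snd_ne_zero p')] at h1
  exact Subtype.ext h1

theorem contDiffAt_rootLift {n : ℤ} {b : ℂ} {p : ℂ × ℂ} (hp : p.2 ≠ 0)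
    (hb : b ^ n = (direction p.2)⁻¹) : ContDiffAt ℝ ∞ (rootLift n b) p := by
  have h1 : ContDiffAt ℝ ∞ (fun p : ℂ × ℂ => direction p.2) p :=
    (contDiffAt_direction hp).comp p contDiffAt_snd
  have h2 : ContDiffAt ℝ ∞ (fun p : ℂ × ℂ => (‖p.2‖ : ℂ)) p :=
    (contDiffAt_ofReal_norm hp).comp p contDiffAt_snd
  have h3 : ContDiffAt ℝ ∞ (fun p : ℂ × ℂ => branch n b (direction p.2)) p :=
    ContDiffAt.comp (g := branch n b) (f := fun p : ℂ × ℂ => direction p.2) p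
      (contDiffAt_branch hb (direction_ne_zero hp)) h1
  exact h3.smul (contDiffAt_fst.prodMk h2)

theorem contDiffAt_rootInv (n : ℤ) {q : ℂ × ℂ} (hq : q.2 ≠ 0) : ContDiffAt ℝ ∞ (rootInv n) q := by
  have h1 : ContDiffAt ℝ ∞ (fun p : ℂ × ℂ => direction p.2) q :=
    (contDiffAt_direction hq).comp q contDiffAt_snd
  have h2 : ContDiffAt ℝ ∞ (fun p : ℂ × ℂ => (‖p.2‖ : ℂ)) q :=
    (contDiffAt_ofReal_norm hq).comp q contDiffAt_snd
  have h3 : ContDiffAt ℝ ∞ (fun p : ℂ × ℂ => direction p.2 ^ (-n)) q :=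
    
    ContDiffAt.comp (g := fun z : ℂ => z ^ (-n)) (f := fun p : ℂ × ℂ => direction p.2) q
      (contDiffAt_zpow_real (-n) (direction_ne_zero hq)) h1
  exact (contDiffAt_fst.mul (h1.inv (direction_ne_zero hq))).prodMk (h2.mul h3)

theorem continuous_iMap {n : ℤ} (hn : n ≠ 0) : Continuous (iMap n) := by
  rw [continuous_iff_continuousAt]
  intro p
  have hp := snd_ne_zero p
  obtain ⟨b, hb1, hb⟩ := exists_zpow_eq_inv hn (norm_direction hp)
  have hb0 : b ≠ 0 := norm_ne_zero_iff.1 (by simp [hb1])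
  -- The principal root in `rootMap` jumps at the negative axis. The branch through `b` induces the
  -- same map to the lens space and is continuous at `p`.
  rw [show iMap n = _ from funext fun p => (mk_rootLift hn hb0 p).symm]
  refine (isLensQuotient_mk hn).continuous.continuousAt.comp ?_
  exact Topology.IsInducing.subtypeVal.continuousAt_iff.2 (ContinuousAt.comp (f := Subtype.val)
    (contDiffAt_rootLift hp hb).continuousAt continuousAt_subtype_val)

theorem isOpenMap_iMap {n : ℤ} (hn : n ≠ 0) : IsOpenMap (iMap n) := by
  intro U hU
  obtain ⟨V, hV, rfl⟩ := isOpen_induced_iff.1 hU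
  have h : iMap n '' (Subtype.val ⁻¹' V) = Quotient.mk (lensSetoid n) ''
      ({q : S3 | q.1.2 ≠ 0} ∩ (fun q : S3 => rootInv n q) ⁻¹' V) := by
    ext x
    constructor
    · rintro ⟨p, hp, rfl⟩
      refine ⟨rootMap n p, ⟨?_, ?_⟩, rfl⟩
      · exact norm_ne_zero_iff.1 (by
          rw [rootMap_eq, norm_rootLift_snd hn one_ne_zero (snd_ne_zero p)]
          exact norm_ne_zero_iff.2 (snd_ne_zero p))
      · rw [Set.mem_preimage, rootMap_eq, rootInv_rootLift hn one_ne_zero (snd_ne_zero p)]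
        exact hp
    · rintro ⟨q, ⟨hq, hqV⟩, rfl⟩
      exact ⟨_, hqV, iMap_rootInv hn q hq⟩
  rw [h]
  refine (isLensQuotient_mk hn).isOpenMap _ (ContinuousOn.isOpen_inter_preimage ?_ ?_ hV)
  · intro q hq
    exact (ContinuousAt.comp (f := Subtype.val) (contDiffAt_rootInv n hq).continuousAt
      continuousAt_subtype_val).continuousWithinAt
  · exact isOpen_ne_fun (by fun_prop) continuous_const

/-! ### Parametrization of the sphere by the glued solid torus -/

theorem normalize_real_smul {t : ℝ} (ht : 0 < t) {p : ℂ × ℂ} (hp : p ∈ S3) :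
    (euclNorm (t • p))⁻¹ • (t • p) = p := by
  rw [euclNorm_real_smul, abs_of_pos ht, mem_S3_iff.1 hp, mul_one, smul_smul,
    inv_mul_cancel₀ ht.ne', one_smul]

/-- The point of the sphere on the ray through `(1, ε ā)`. -/
def coreVec (ε : ℝ) (a : ℂ) : ℂ × ℂ :=
  (euclNorm (1, (ε : ℂ) * star a))⁻¹ • ((1 : ℂ), (ε : ℂ) * star a)

theorem one_prod_ne_zero (x : ℂ) : ((1 : ℂ), x) ≠ 0 := fun h =>
  one_ne_zero (congrArg Prod.fst h)

theorem coreVec_mem_S3 (ε : ℝ) (a : ℂ) : coreVec ε a ∈ S3 :=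
  inv_euclNorm_smul_mem (one_prod_ne_zero _)

/-- A local lift to the sphere of the map from the glued solid torus to the lens space. -/
def coreLift (ε : ℝ) (n : ℤ) (b : ℂ) (x : ℂ × ℂ) : ℂ × ℂ := branch n b x.2 • coreVec ε x.1

/-- The coordinates of a point of the sphere in the glued solid torus. -/
def coreInv (ε : ℝ) (n : ℤ) (q : ℂ × ℂ) : ℂ × ℂ :=
  (star (q.2 / q.1) / ε, direction q.1 ^ (-n))

/-- For this value of `a` the vector `(1, ε ā)` is `(1, q.2 / q.1)`, a multiple of `q` by `q.1⁻¹`;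
normalizing leaves only the phase. -/
theorem coreVec_star_div {ε : ℝ} (hε : 0 < ε) {q : ℂ × ℂ} (hq : q ∈ S3) (hq1 : q.1 ≠ 0) :
    coreVec ε (star (q.2 / q.1) / ε) = (direction q.1)⁻¹ • q := by
  have hε' : (ε : ℂ) ≠ 0 := by exact_mod_cast hε.ne'
  have hd := norm_direction hq1
  have h1 : ((1 : ℂ), (ε : ℂ) * star (star (q.2 / q.1) / (ε : ℂ))) =
      (‖q.1‖⁻¹ : ℝ) • ((direction q.1)⁻¹ • q) := by
    have h2 : (‖q.1‖ : ℂ) ≠ 0 := by simpa using hq1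
    refine Prod.ext ?_ ?_
    · simp only [direction, Prod.smul_fst, smul_eq_mul, Complex.real_smul]
      push_cast
      field_simp
    · simp only [direction, Prod.smul_snd, smul_eq_mul, Complex.real_smul, star_div₀, star_star]
      rw [show star (ε : ℂ) = ε from Complex.conj_ofReal ε]
      push_cast
      field_simp
  rw [coreVec, h1, normalize_real_smul (inv_pos.2 (norm_pos_iff.2 hq1))]
  exact smul_mem_S3 (by rw [norm_inv, hd, inv_one]) hq

theorem coreInv_smul_coreVec {ε : ℝ} (hε : 0 < ε) (n : ℤ) {c : ℂ} (hc : ‖c‖ = 1) (a : ℂ) :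
    coreInv ε n (c • coreVec ε a) = (a, c ^ (-n)) := by
  have hε' : (ε : ℂ) ≠ 0 := by exact_mod_cast hε.ne'
  have hc0 : c ≠ 0 := norm_ne_zero_iff.1 (by simp [hc])
  have hN := inv_pos.2 (euclNorm_pos (one_prod_ne_zero ((ε : ℂ) * star a)))
  have hN' : (((euclNorm (1, (ε : ℂ) * star a))⁻¹ : ℝ) : ℂ) ≠ 0 := by exact_mod_cast hN.ne'
  refine Prod.ext ?_ ?_
  · simp only [coreInv, coreVec, Prod.smul_fst, Prod.smul_snd, smul_eq_mul, Complex.real_smul,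
      mul_one]
    rw [mul_div_mul_left _ _ hc0, mul_div_cancel_left₀ _ hN', star_mul', star_star,
      show star (ε : ℂ) = ε from Complex.conj_ofReal ε, mul_div_cancel_left₀ _ hε']
  · simp only [coreInv, coreVec, Prod.smul_fst, smul_eq_mul, Complex.real_smul, mul_one,
      direction_mul, direction_eq_self hc]
    rw [direction_ofReal hN, mul_one]

theorem norm_snd_smul_coreVec {ε : ℝ} (hε : 0 < ε) (c a : ℂ) :
    ‖(c • coreVec ε a).2‖ = ε * ‖a‖ * ‖(c • coreVec ε a).1‖ := by
  simp only [coreVec, Prod.smul_fst, Prod.smul_snd, smul_eq_mul, Complex.real_smul, mul_one,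
    norm_mul, norm_star, Complex.norm_real, Real.norm_eq_abs, abs_of_pos hε]
  ring

theorem smul_coreVec_fst_ne_zero (ε : ℝ) {c : ℂ} (hc : ‖c‖ = 1) (a : ℂ) :
    (c • coreVec ε a).1 ≠ 0 := by
  have hc0 : c ≠ 0 := norm_ne_zero_iff.1 (by simp [hc])
  simpa [coreVec, hc0] using euclNorm_pos (one_prod_ne_zero ((ε : ℂ) * star a)) |>.ne'

theorem contDiff_coreVec (ε : ℝ) : ContDiff ℝ ∞ (coreVec ε) := by
  have h : ContDiff ℝ ∞ fun a : ℂ => ((1 : ℂ), (ε : ℂ) * star a) :=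
    contDiff_const.prodMk (contDiff_const.mul (starL' ℝ : ℂ ≃L[ℝ] ℂ).contDiff)
  rw [contDiff_iff_contDiffAt]
  intro a
  exact (ContDiffAt.comp (g := fun w => (euclNorm w)⁻¹)
    (f := fun a : ℂ => ((1 : ℂ), (ε : ℂ) * star a)) a
    (contDiffAt_inv_euclNorm (one_prod_ne_zero _)) h.contDiffAt).smul h.contDiffAt

theorem contDiffAt_coreLift (ε : ℝ) {n : ℤ} {b : ℂ} {x : ℂ × ℂ} (hb : b ^ n = x.2⁻¹)
    (hx : x.2 ≠ 0) : ContDiffAt ℝ ∞ (coreLift ε n b) x := by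
  have h1 : ContDiffAt ℝ ∞ (fun x : ℂ × ℂ => branch n b x.2) x :=
    ContDiffAt.comp (g := branch n b) (f := Prod.snd) x (contDiffAt_branch hb hx) contDiffAt_snd
  exact h1.smul ((contDiff_coreVec ε).contDiffAt.comp x contDiffAt_fst)

theorem contDiffAt_coreInv (ε : ℝ) (n : ℤ) {q : ℂ × ℂ} (hq : q.1 ≠ 0) :
    ContDiffAt ℝ ∞ (coreInv ε n) q := by
  have h1 : ContDiffAt ℝ ∞ (fun p : ℂ × ℂ => direction p.1 ^ (-n)) q :=
    ContDiffAt.comp (g := fun z : ℂ => z ^ (-n)) (f := fun p : ℂ × ℂ => direction p.1) q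
      (contDiffAt_zpow_real (-n) (direction_ne_zero hq))
      ((contDiffAt_direction hq).comp q contDiffAt_fst)
  have h2 : ContDiffAt ℝ ∞ (fun p : ℂ × ℂ => p.2 * p.1⁻¹) q :=
    contDiffAt_snd.mul (contDiffAt_fst.inv hq)
  have h3 : ContDiffAt ℝ ∞ (fun p : ℂ × ℂ => star (p.2 * p.1⁻¹) * (ε : ℂ)⁻¹) q :=
    ((starL' ℝ : ℂ ≃L[ℝ] ℂ).contDiff.contDiffAt.comp q h2).mul contDiffAt_const
  exact h3.prodMk h1

theorem coreLift_mem_S3 {ε : ℝ} {n : ℤ} (hn : n ≠ 0) {b : ℂ} (hb : b ≠ 0) {x : ℂ × ℂ}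
    (hx : ‖x.2‖ = 1) : coreLift ε n b x ∈ S3 :=
  smul_mem_S3 (norm_branch hn hb hx) (coreVec_mem_S3 ε _)

theorem coreInv_coreLift {ε : ℝ} (hε : 0 < ε) {n : ℤ} (hn : n ≠ 0) {b : ℂ} (hb : b ≠ 0)
    {x : ℂ × ℂ} (hx : ‖x.2‖ = 1) : coreInv ε n (coreLift ε n b x) = x := by
  rw [coreLift, coreInv_smul_coreVec hε n (norm_branch hn hb hx), zpow_neg, branch_zpow hn hb,
    inv_inv]

theorem coreInv_smul_root {ε : ℝ} {n : ℤ} {c : ℂ} (hc : ‖c‖ = 1) (hcn : c ^ n = 1) (q : ℂ × ℂ) :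
    coreInv ε n (c • q) = coreInv ε n q := by
  have hc0 : c ≠ 0 := norm_ne_zero_iff.1 (by simp [hc])
  simp only [coreInv, Prod.smul_fst, Prod.smul_snd, smul_eq_mul, direction_mul,
    direction_eq_self hc, mul_div_mul_left _ _ hc0, mul_zpow, zpow_neg c, hcn, inv_one, one_mul]

/-- The map from the glued solid torus to the lens space. -/
def coreMap (ε : ℝ) {n : ℤ} (hn : n ≠ 0) (x : D2 × Circle) : Lens n :=
  Quotient.mk (lensSetoid n)
    ⟨coreLift ε n 1 ((x.1 : ℂ), (x.2 : ℂ)), coreLift_mem_S3 hn one_ne_zero (Circle.norm_coe x.2)⟩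

theorem coreMap_eq {ε : ℝ} {n : ℤ} (hn : n ≠ 0) {x : D2 × Circle} {c : ℂ} {q : S3}
    (hc : c ^ n = (x.2 : ℂ)⁻¹) (hq : q.1 = c • coreVec ε x.1) :
    Quotient.mk (lensSetoid n) q = coreMap ε hn x := by
  refine mk_eq_of_zpow_eq hn (c' := branch n 1 x.2) hq rfl ?_ ?_
  · rw [hc, branch_zpow hn one_ne_zero]
  · rintro rfl
    rw [zero_zpow n hn] at hc
    exact inv_ne_zero (Circle.coe_ne_zero x.2) hc.symm

theorem mk_coreLift {ε : ℝ} {n : ℤ} (hn : n ≠ 0) {b : ℂ} (hb : b ≠ 0) (x : D2 × Circle) :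
    Quotient.mk (lensSetoid n) ⟨coreLift ε n b ((x.1 : ℂ), (x.2 : ℂ)),
      coreLift_mem_S3 hn hb (Circle.norm_coe x.2)⟩ = coreMap ε hn x :=
  coreMap_eq hn (branch_zpow hn hb) rfl

theorem continuous_coreMap (ε : ℝ) {n : ℤ} (hn : n ≠ 0) : Continuous (coreMap ε hn) := by
  rw [continuous_iff_continuousAt]
  intro x
  obtain ⟨b, hb1, hb⟩ := exists_zpow_eq_inv hn (Circle.norm_coe x.2)
  have hb0 : b ≠ 0 := norm_ne_zero_iff.1 (by simp [hb1])
  rw [show coreMap ε hn = _ from funext fun p => (mk_coreLift hn hb0 p).symm]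
  refine (isLensQuotient_mk hn).continuous.continuousAt.comp ?_
  exact Topology.IsInducing.subtypeVal.continuousAt_iff.2 (ContinuousAt.comp
    (g := coreLift ε n b) (f := fun x : D2 × Circle => ((x.1 : ℂ), (x.2 : ℂ)))
    (contDiffAt_coreLift ε hb (Circle.coe_ne_zero x.2)).continuousAt (by fun_prop))

theorem coreInv_eq_of_mk_eq {ε : ℝ} {n : ℤ} (hn : n ≠ 0) {q q' : S3}
    (h : Quotient.mk (lensSetoid n) q = Quotient.mk (lensSetoid n) q') :
    coreInv ε n q = coreInv ε n q' := by
  obtain ⟨k, hk⟩ := Quotient.exact h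
  rw [hk, coreInv_smul_root (norm_zeta_zpow hn k) (zeta_zpow_zpow hn k)]

theorem coreMap_injective {ε : ℝ} (hε : 0 < ε) {n : ℤ} (hn : n ≠ 0) :
    Function.Injective (coreMap ε hn) := by
  intro x x' h
  have h1 := coreInv_eq_of_mk_eq (ε := ε) hn h
  rw [coreInv_coreLift hε hn one_ne_zero (Circle.norm_coe x.2),
    coreInv_coreLift hε hn one_ne_zero (Circle.norm_coe x'.2)] at h1
  exact Prod.ext (Subtype.ext (congrArg Prod.fst h1)) (Circle.ext (congrArg Prod.snd h1))

/-! ### The tube -/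

/-- The vector `(z, ε w zⁿ)`, whose normalization is the point `j(z, w)` of the tube. -/
def tubeVec (ε : ℝ) (n : ℤ) (x : ℂ × ℂ) : ℂ × ℂ := (x.1, (ε : ℂ) * x.2 * x.1 ^ n)

theorem euclNorm_tubeVec (ε : ℝ) (n : ℤ) (z : Circle) (w : ℂ) :
    euclNorm (tubeVec ε n (z, w)) = √(1 + ‖(ε : ℂ) * w‖ ^ 2) := by
  simp [euclNorm, tubeVec, Circle.norm_coe]

theorem tube_val (ε : ℝ) (n : ℤ) (x : Circle × D2) : (tube ε n x).1 =
    (euclNorm (tubeVec ε n ((x.1 : ℂ), (x.2 : ℂ))))⁻¹ • tubeVec ε n ((x.1 : ℂ), (x.2 : ℂ)) := by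
  rw [euclNorm_tubeVec, ← one_div]
  exact Complex.coe_smul _ _

theorem tubeVec_ne_zero (ε : ℝ) (n : ℤ) {x : ℂ × ℂ} (hx : x.1 ≠ 0) : tubeVec ε n x ≠ 0 :=
  fun h => hx (congrArg Prod.fst h)

theorem normalize_tubeVec {ε : ℝ} (hε : 0 < ε) (n : ℤ) {p : ℂ × ℂ} (hp : p ∈ S3) (hp1 : p.1 ≠ 0) :
    (euclNorm (tubeVec ε n (direction p.1,
      ((‖p.2‖ / (ε * ‖p.1‖) : ℝ) : ℂ) * (direction p.2 * direction p.1 ^ (-n)))))⁻¹ •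
      tubeVec ε n (direction p.1,
        ((‖p.2‖ / (ε * ‖p.1‖) : ℝ) : ℂ) * (direction p.2 * direction p.1 ^ (-n))) = p := by
  have hε' : (ε : ℂ) ≠ 0 := by exact_mod_cast hε.ne'
  have h2 : (‖p.1‖ : ℂ) ≠ 0 := by simpa using hp1
  have hd := direction_ne_zero hp1
  have h1 : tubeVec ε n (direction p.1,
      ((‖p.2‖ / (ε * ‖p.1‖) : ℝ) : ℂ) * (direction p.2 * direction p.1 ^ (-n))) =
      ‖p.1‖⁻¹ • p := by
    refine Prod.ext ?_ ?_
    · simp only [tubeVec, direction, Prod.smul_fst, Complex.real_smul]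
      push_cast
      field_simp
    · simp only [tubeVec, Prod.smul_snd, Complex.real_smul, zpow_neg]
      have h3 := zpow_ne_zero n hd
      conv_rhs => rw [← norm_mul_direction p.2]
      push_cast
      field_simp
  rw [h1, normalize_real_smul (inv_pos.2 (norm_pos_iff.2 hp1)) hp]

/-- This compatibility is why `i_n` extends. With `r = 1` it gives well-definedness on the gluing
torus; for other `r` it identifies points inside the tube with points of the solid torus. -/
theorem iMap_eq_coreMap {ε : ℝ} (hε : 0 < ε) {n : ℤ} (hn : n ≠ 0) {p : ↥(S3 \ unknot)}
    {x : D2 × Circle} {z : ℂ} {r : ℝ} (hr : 0 < r) (hz : ‖z‖ = 1) (hx : (x.1 : ℂ) = r * z)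
    (hp : p.1 = (euclNorm (tubeVec ε n (z, r * x.2)))⁻¹ • tubeVec ε n (z, r * x.2)) :
    iMap n p = coreMap ε hn x := by
  have hz0 : z ≠ 0 := norm_ne_zero_iff.1 (by simp [hz])
  have hN := euclNorm_pos (tubeVec_ne_zero ε n (x := (z, r * (x.2 : ℂ))) hz0)
  have hNe : euclNorm (tubeVec ε n (z, r * x.2)) = euclNorm (1, (ε : ℂ) * star (x.1 : ℂ)) := by
    simp [euclNorm, tubeVec, hz, hx, Circle.norm_coe]
  have hsz : star z = z⁻¹ := (Complex.inv_eq_conj hz).symm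
  rw [← mk_coreLift hn one_ne_zero x]
  symm
  -- The phase of `p.2` is `w zⁿ`, so a root of its inverse is a root of `w⁻¹` times `z⁻¹`; that
  -- factor turns `(1, ε ā)` into `z⁻¹ (z, ε r)`.
  refine iMap_eq hn (c := branch n 1 x.2 * z⁻¹) ?_ ?_
  · rw [mul_zpow, branch_zpow hn one_ne_zero, hp, hNe]
    rw [hNe] at hN
    simp only [tubeVec, Prod.smul_snd, Complex.real_smul, direction_mul]
    rw [direction_ofReal (inv_pos.2 hN), direction_ofReal hε, direction_ofReal hr,
      direction_eq_self (Circle.norm_coe x.2), direction_eq_self (z := z ^ n) (by simp [hz])]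
    simp [mul_comm]
  · change branch n 1 x.2 • coreVec ε x.1 = _
    rw [mul_smul]
    congr 1
    rw [hp, hNe, coreVec]
    have hN2 := euclNorm_pos (one_prod_ne_zero ((ε : ℂ) * star (x.1 : ℂ)))
    refine Prod.ext ?_ ?_
    · simp only [tubeVec, Prod.smul_fst, smul_eq_mul, Complex.real_smul]
      field_simp
    · simp only [tubeVec, Prod.smul_snd, smul_eq_mul, Complex.real_smul, norm_mul, norm_zpow, hz,
        Circle.norm_coe, Complex.norm_real, Real.norm_eq_abs, abs_of_pos hε, abs_of_pos hr,
        abs_of_pos (inv_pos.2 hN2), one_zpow, mul_one]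
      rw [hx, star_mul', hsz, show star (r : ℂ) = r from Complex.conj_ofReal r]
      push_cast
      ring

theorem mem_range_tube {ε : ℝ} (hε : 0 < ε) (n : ℤ) {p : S3} (hp : p.1.1 ≠ 0)
    (h : ‖p.1.2‖ ≤ ε * ‖p.1.1‖) : p ∈ Set.range (tube ε n) := by
  have hd := norm_direction hp
  have hp1 := norm_pos_iff.2 hp
  refine ⟨(⟨direction p.1.1, by simp [Submonoid.unitSphere, hd]⟩,
    ⟨((‖p.1.2‖ / (ε * ‖p.1.1‖) : ℝ) : ℂ) * (direction p.1.2 * direction p.1.1 ^ (-n)), ?_⟩),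
    Subtype.ext ?_⟩
  · rw [mem_closedBall_zero_iff, norm_mul, norm_mul, norm_zpow, hd, one_zpow, mul_one,
      Complex.norm_real, Real.norm_of_nonneg (by positivity)]
    have h2 : ‖direction p.1.2‖ ≤ 1 := by
      by_cases h0 : p.1.2 = 0
      · simp [h0, direction]
      · exact (norm_direction h0).le
    exact mul_le_one₀ (div_le_one_of_le₀ h (by positivity)) (norm_nonneg _) h2
  · rw [tube_val]
    exact normalize_tubeVec hε n p.2 hp

theorem fst_ne_zero_of_norm_lt {ε : ℝ} {p : S3} (h : ‖p.1.2‖ < ε * ‖p.1.1‖) : p.1.1 ≠ 0 := by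
  intro h0
  rw [h0, norm_zero, mul_zero] at h
  exact (norm_nonneg _).not_gt h

theorem mem_interior_range_tube {ε : ℝ} (hε : 0 < ε) (n : ℤ) {p : S3}
    (h : ‖p.1.2‖ < ε * ‖p.1.1‖) : p ∈ interior (Set.range (tube ε n)) := by
  have hop : IsOpen {p : S3 | ‖p.1.2‖ < ε * ‖p.1.1‖} := isOpen_lt (by fun_prop) (by fun_prop)
  exact interior_maximal (fun q hq =>
    mem_range_tube hε n (fst_ne_zero_of_norm_lt hq) (le_of_lt hq)) hop h

theorem unknot_snd {p : ℂ × ℂ} (hp : p ∈ unknot) : p.2 = 0 ∧ ‖p.1‖ = 1 := by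
  obtain ⟨z, rfl⟩ := hp
  exact ⟨rfl, Circle.norm_coe z⟩

theorem mem_interior_of_mem_unknot {ε : ℝ} (hε : 0 < ε) (n : ℤ) {p : S3} (hp : p.1 ∈ unknot) :
    p ∈ interior (Set.range (tube ε n)) := by
  obtain ⟨h1, h2⟩ := unknot_snd hp
  exact mem_interior_range_tube hε n (by simpa [h1, h2] using hε)

/-! ### The homeomorphism from the surgered manifold to the lens space -/

/-- A point outside the interior of the tube, as a point of the complement of the unknot. -/
def outside {ε : ℝ} (hε : 0 < ε) {n : ℤ} (p : {p : S3 // p ∉ interior (Set.range (tube ε n))}) :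
    ↥(S3 \ unknot) :=
  ⟨p.1.1, p.1.2, fun h => p.2 (mem_interior_of_mem_unknot hε n h)⟩

/-- The extension of `i_n` to the surgered manifold. -/
def toLens {ε : ℝ} (hε : 0 < ε) {n : ℤ} (hn : n ≠ 0) : Surgery (tube ε n) → Lens n :=
  Quot.lift (Sum.elim (fun p => iMap n (outside hε p)) (coreMap ε hn)) (by
    rintro _ _ ⟨p, z, w, rfl, rfl, h⟩
    refine iMap_eq_coreMap hε hn (z := z) one_pos (Circle.norm_coe z) (by simp [toDisk]) ?_
    have h2 := (congrArg Subtype.val h).trans (tube_val ε n (z, toDisk w))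
    rw [Complex.ofReal_one, one_mul]
    exact h2)

theorem continuous_toLens {ε : ℝ} (hε : 0 < ε) {n : ℤ} (hn : n ≠ 0) :
    Continuous (toLens hε hn) := by
  refine continuous_quot_lift _ (Continuous.sumElim ?_ (continuous_coreMap ε hn))
  refine (continuous_iMap hn).comp ?_
  exact Continuous.subtype_mk (by fun_prop) _

theorem toLens_complementInclusion {ε : ℝ} (hε : 0 < ε) {n : ℤ} (hn : n ≠ 0)
    (p : ↥(S3 \ unknot)) : toLens hε hn (complementInclusion ε n p) = iMap n p := by
  unfold complementInclusion
  split_ifs with h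
  · have hu := norm_snd_le_of_mem_range (interior_subset h)
    have hp1 := norm_pos_iff.2 hu.1
    have hp2 := norm_pos_iff.2 (snd_ne_zero p)
    symm
    refine iMap_eq_coreMap hε hn (z := direction p.1.1)
      (r := ‖p.1.2‖ / (ε * ‖p.1.1‖)) (by positivity) (norm_direction hu.1) rfl ?_
    refine (normalize_tubeVec hε n p.2.1 hu.1).symm.trans ?_
    simp only [Circle.coe_mul, Circle.coe_zpow]
    rfl
  · rfl

theorem toLens_surjective {ε : ℝ} (hε : 0 < ε) {n : ℤ} (hn : n ≠ 0) :
    Function.Surjective (toLens hε hn) := by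
  intro x
  obtain ⟨q, rfl⟩ := Quotient.mk_surjective x
  by_cases h : q.1.2 = 0
  · have h2 : ‖q.1.1‖ ^ 2 + ‖q.1.2‖ ^ 2 = 1 := q.2
    have h1 : q.1.1 ≠ 0 := by
      intro h1
      simp [h, h1] at h2
    -- The points `(u, 0)` missed by `i_n` come from the core `{0} × S¹`, where `b = u` forces `w =
    -- u ^ (-n)`.
    refine ⟨Quot.mk _ (Sum.inr (⟨0, by simp⟩,
      ⟨direction q.1.1 ^ (-n), by simp [Submonoid.unitSphere, norm_direction h1]⟩)), ?_⟩
    refine (coreMap_eq hn (c := direction q.1.1) ?_ ?_).symm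
    · simp
    · have := coreVec_star_div hε q.2 h1
      simp only [h, zero_div, star_zero] at this
      change _ = _ • coreVec ε 0
      rw [this, smul_smul, mul_inv_cancel₀ (direction_ne_zero h1), one_smul]
  · exact ⟨complementInclusion ε n _, (toLens_complementInclusion hε hn _).trans
      (iMap_rootInv hn q h)⟩

/-- Outside the tube `|v| ≥ ε |u|`, while `coreMap` has `|v| = ε |a| |u|` with `|a| ≤ 1`; equality
of images therefore forces `|a| = 1`. The gluing partner of `x` on the torus then has the same image
as `p`, and `i_n` is injective. -/
theorem mk_inl_eq_mk_inr_of_iMap_eq {ε : ℝ} (hε : 0 < ε) {n : ℤ} (hn : n ≠ 0)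
    (p : {p : S3 // p ∉ interior (Set.range (tube ε n))}) (x : D2 × Circle)
    (h : iMap n (outside hε p) = coreMap ε hn x) :
    (Quot.mk (gluing (tube ε n)) (Sum.inl p)) = Quot.mk _ (Sum.inr x) := by
  have hp2 := snd_ne_zero (outside hε p)
  have h1 : ε * ‖p.1.1.1‖ ≤ ‖p.1.1.2‖ := not_lt.1 fun h => p.2 (mem_interior_range_tube hε n h)
  have ha : ‖(x.1 : ℂ)‖ = 1 := by
    obtain ⟨k, hk⟩ := Quotient.exact h
    have e1 := congrArg (fun q : ℂ × ℂ => ‖q.1‖) hk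
    have e2 := congrArg (fun q : ℂ × ℂ => ‖q.2‖) hk
    simp only [Prod.smul_fst, Prod.smul_snd, smul_eq_mul, norm_mul, norm_zeta_zpow hn, one_mul,
      rootMap_eq, norm_rootLift_fst hn one_ne_zero hp2,
      norm_rootLift_snd hn one_ne_zero hp2, coreLift] at e1 e2
    have hb := norm_branch hn one_ne_zero (Circle.norm_coe x.2)
    have e0 := norm_snd_smul_coreVec hε (branch n 1 x.2) x.1
    have e4 := norm_pos_iff.2 (smul_coreVec_fst_ne_zero ε hb x.1)
    simp only [Prod.smul_fst, Prod.smul_snd, smul_eq_mul, norm_mul] at e0 e4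
    rw [e1, e2] at e0
    rw [e1] at e4
    change 0 < ‖p.1.1.1‖ at e4
    have e3 : ε * ‖p.1.1.1‖ ≤ ε * ‖(x.1 : ℂ)‖ * ‖p.1.1.1‖ := h1.trans_eq e0
    have e5 : 1 ≤ ‖(x.1 : ℂ)‖ := by
      by_contra e6
      push Not at e6
      have : ε * ‖(x.1 : ℂ)‖ * ‖p.1.1.1‖ < ε * ‖p.1.1.1‖ := by
        have := mul_pos hε e4
        nlinarith
      linarith
    exact le_antisymm (mem_closedBall_zero_iff.1 x.1.2) e5
  let z : Circle := ⟨x.1, by simp [Submonoid.unitSphere, ha]⟩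
  have hxz : x = (toDisk z, x.2) := rfl
  have hsnd : (tube ε n (z, toDisk x.2)).1.2 ≠ 0 := by
    rw [tube_val]
    have := euclNorm_pos (tubeVec_ne_zero ε n
      (x := ((z : ℂ), ((toDisk x.2 : D2) : ℂ))) (Circle.coe_ne_zero z))
    simp only [Prod.smul_snd, Complex.real_smul]
    refine mul_ne_zero (by exact_mod_cast (inv_pos.2 this).ne') ?_
    exact mul_ne_zero (mul_ne_zero (by exact_mod_cast hε.ne') (Circle.coe_ne_zero x.2))
      (zpow_ne_zero n (Circle.coe_ne_zero z))
  have h2 : iMap n ⟨(tube ε n (z, toDisk x.2)).1, (tube ε n (z, toDisk x.2)).2,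
      not_mem_unknot hsnd⟩ = coreMap ε hn x := by
    refine iMap_eq_coreMap hε hn (z := z) one_pos (Circle.norm_coe z) (by simp [z]) ?_
    simpa [toDisk] using tube_val ε n (z, toDisk x.2)
  have h3 := congrArg Subtype.val (iMap_injective hn (h.trans h2.symm))
  exact Quot.sound ⟨p, z, x.2, rfl, by rw [hxz], Subtype.ext h3⟩

theorem toLens_injective {ε : ℝ} (hε : 0 < ε) {n : ℤ} (hn : n ≠ 0) :
    Function.Injective (toLens hε hn) := by
  rintro ⟨p | x⟩ ⟨p' | x'⟩ h
  · have h1 := congrArg Subtype.val (iMap_injective hn (show iMap n (outside hε p) =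
      iMap n (outside hε p') from h))
    have h2 : p = p' := Subtype.ext (Subtype.ext h1)
    rw [h2]
  · exact mk_inl_eq_mk_inr_of_iMap_eq hε hn p x' h
  · exact (mk_inl_eq_mk_inr_of_iMap_eq hε hn p' x h.symm).symm
  · have h1 : x = x' := coreMap_injective hε hn h
    rw [h1]

theorem compactSpace_surgery (ε : ℝ) (n : ℤ) : CompactSpace (Surgery (tube ε n)) := by
  have : CompactSpace {p : S3 // p ∉ interior (Set.range (tube ε n))} :=
    isCompact_iff_compactSpace.1 isOpen_interior.isClosed_compl.isCompact
  have : CompactSpace D2 := isCompact_iff_compactSpace.1 (isCompact_closedBall 0 1)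
  infer_instance

/-- The homeomorphism from the surgered manifold to the lens space. -/
def lensHomeomorph {ε : ℝ} (hε : 0 < ε) {n : ℤ} (hn : n ≠ 0) : Surgery (tube ε n) ≃ₜ Lens n :=
  haveI := compactSpace_surgery ε n
  haveI := (isLensQuotient_mk hn).t2Space hn
  Continuous.homeoOfEquivCompactToT2
    (f := Equiv.ofBijective (toLens hε hn) ⟨toLens_injective hε hn, toLens_surjective hε hn⟩)
    (continuous_toLens hε hn)

theorem lensHomeomorph_complementInclusion {ε : ℝ} (hε : 0 < ε) {n : ℤ} (hn : n ≠ 0)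
    (p : ↥(S3 \ unknot)) : lensHomeomorph hε hn (complementInclusion ε n p) = iMap n p :=
  toLens_complementInclusion hε hn p

theorem complementInclusion_eq {ε : ℝ} (hε : 0 < ε) {n : ℤ} (hn : n ≠ 0) :
    complementInclusion ε n = (lensHomeomorph hε hn).symm ∘ iMap n :=
  funext fun p => ((lensHomeomorph hε hn).symm_apply_eq.2
    (lensHomeomorph_complementInclusion hε hn p).symm).symm

theorem isOpenEmbedding_complementInclusion {ε : ℝ} (hε : 0 < ε) {n : ℤ} (hn : n ≠ 0) :
    Topology.IsOpenEmbedding (complementInclusion ε n) := by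
  rw [complementInclusion_eq hε hn]
  exact (lensHomeomorph hε hn).symm.isOpenEmbedding.comp
    (.of_continuous_injective_isOpenMap (continuous_iMap hn) (iMap_injective hn)
      (isOpenMap_iMap hn))

theorem dense_snd_ne_zero : Dense {q : S3 | q.1.2 ≠ 0} := by
  intro q
  by_cases h : q.1.2 = 0
  · have hq : ‖q.1.1‖ = 1 := by
      have h2 : ‖q.1.1‖ ^ 2 + ‖q.1.2‖ ^ 2 = 1 := q.2
      rw [h] at h2
      nlinarith [norm_nonneg q.1.1, norm_zero (E := ℂ)]
    -- A great circle arc leaves the unknot at `q` towards `(0, 1)`.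
    have hmem : ∀ t : ℝ, ((Real.cos t : ℂ) * q.1.1, (Real.sin t : ℂ)) ∈ S3 := by
      intro t
      change ‖_‖ ^ 2 + ‖_‖ ^ 2 = 1
      rw [norm_mul, hq, mul_one, Complex.norm_real, Complex.norm_real, Real.norm_eq_abs,
        Real.norm_eq_abs, sq_abs, sq_abs, Real.cos_sq_add_sin_sq]
    have hlim : Filter.Tendsto (fun t : ℝ => (⟨_, hmem t⟩ : S3)) (𝓝[>] 0) (𝓝 q) := by
      have hc : Continuous fun t : ℝ => (⟨_, hmem t⟩ : S3) := by fun_prop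
      have h0 : (⟨_, hmem 0⟩ : S3) = q :=
        Subtype.ext (Prod.ext (by simp) (by simp [h]))
      have := hc.tendsto 0
      rw [h0] at this
      exact this.mono_left nhdsWithin_le_nhds
    refine mem_closure_of_tendsto hlim ?_
    filter_upwards [Ioo_mem_nhdsGT Real.pi_pos] with t ht
    have := Real.sin_pos_of_pos_of_lt_pi ht.1 ht.2
    exact Complex.ofReal_ne_zero.2 this.ne'
  · exact subset_closure h

theorem denseRange_complementInclusion {ε : ℝ} (hε : 0 < ε) {n : ℤ} (hn : n ≠ 0) :
    DenseRange (complementInclusion ε n) := by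
  rw [complementInclusion_eq hε hn]
  refine (lensHomeomorph hε hn).symm.surjective.denseRange.comp ?_ (lensHomeomorph hε hn).symm.continuous
  have h := (isLensQuotient_mk hn).surjective.denseRange.dense_image
    (isLensQuotient_mk hn).continuous dense_snd_ne_zero
  refine h.mono ?_
  rintro _ ⟨q, hq, rfl⟩
  exact ⟨_, iMap_rootInv hn q hq⟩

theorem complementInclusion_tube {ε : ℝ} (hε : 0 < ε) {n : ℤ} (hn : n ≠ 0) {z w : Circle} {t : D2}
    {p : ↥(S3 \ unknot)} {a : D2} {r : ℝ} (hr : 0 < r) (ht : (t : ℂ) = r * w)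
    (ha : (a : ℂ) = r * z) (hp : (p : ℂ × ℂ) = tube ε n (z, t)) :
    complementInclusion ε n p = Quot.mk _ (Sum.inr (a, w)) := by
  apply toLens_injective hε hn
  rw [toLens_complementInclusion]
  refine iMap_eq_coreMap hε hn (z := z) hr (Circle.norm_coe z) ha ?_
  rw [hp, tube_val, ht]

theorem existsUnique_homeomorph {ε : ℝ} (hε : 0 < ε) {n : ℤ} (hn : n ≠ 0) :
    ∃! Φ : Surgery (tube ε n) ≃ₜ Lens n, ∀ p, Φ (complementInclusion ε n p) = iMap n p := by
  have := (isLensQuotient_mk hn).t2Space hn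
  refine ⟨lensHomeomorph hε hn, lensHomeomorph_complementInclusion hε hn, fun Ψ hΨ => ?_⟩
  refine Homeomorph.ext fun x => congrFun ((denseRange_complementInclusion hε hn).equalizer
    Ψ.continuous (lensHomeomorph hε hn).continuous (funext fun p => ?_)) x
  exact (hΨ p).trans (lensHomeomorph_complementInclusion hε hn p).symm

/-! ### The Jacobian determinant of the inverse of `i_n` -/

theorem hasDerivAt_norm_line {z w : ℂ} (hz : z ≠ 0) :
    HasDerivAt (fun t : ℝ => ‖z + (t : ℂ) * w‖) ((star (direction z) * w).re) 0 := by
  have hl : HasDerivAt (fun t : ℝ => z + (t : ℂ) * w) w 0 := by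
    simpa using ((Complex.ofRealCLM.hasDerivAt (x := (0 : ℝ))).mul_const w).const_add z
  have h2 := hl.norm_sq
  simp only [Complex.ofReal_zero, zero_mul, add_zero] at h2
  have h3 := h2.sqrt (by simpa using hz)
  simp only [Complex.ofReal_zero, zero_mul, add_zero, Real.sqrt_sq (norm_nonneg _)] at h3
  convert h3 using 1
  have h0 : ‖z‖ ≠ 0 := norm_ne_zero_iff.2 hz
  rw [Complex.inner, direction, mul_div_mul_left _ _ two_ne_zero]
  simp [Complex.div_re, Complex.div_im, Complex.normSq_apply]
  field_simp
  ring

/-- In the rotating frame given by `z`, the real part of `z̄ w / |z|` changes the length and only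
the imaginary part turns the direction. -/
theorem hasDerivAt_direction_line {z w : ℂ} (hz : z ≠ 0) :
    HasDerivAt (fun t : ℝ => direction (z + (t : ℂ) * w))
      (direction z * (Complex.I * (((star (direction z) * w).im / ‖z‖ : ℝ) : ℂ))) 0 := by
  have hl : HasDerivAt (fun t : ℝ => z + (t : ℂ) * w) w 0 := by
    simpa using ((Complex.ofRealCLM.hasDerivAt (x := (0 : ℝ))).mul_const w).const_add z
  have h0 : (‖z‖ : ℂ) ≠ 0 := by simpa using hz
  have h := hl.div ((hasDerivAt_norm_line (w := w) hz).ofReal_comp) (by simpa using hz)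
  simp only [Complex.ofReal_zero, zero_mul, add_zero] at h
  refine h.congr_deriv ?_
  set c := direction z with hc
  have hcs : c * star c = 1 := by
    rw [Complex.star_def, Complex.mul_conj, Complex.normSq_eq_norm_sq, norm_direction hz]
    simp
  have hw : w = c * (((star c * w).re : ℂ) + ((star c * w).im : ℂ) * Complex.I) := by
    rw [Complex.re_add_im, ← mul_assoc, hcs, one_mul]
  have hz2 : z = ‖z‖ * c := (norm_mul_direction z).symm
  set ρ := (star c * w).re
  set μ := (star c * w).im
  rw [hw]
  push_cast
  field_simp
  linear_combination (-(ρ : ℂ)) * hz2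

/-- The product rule in polar coordinates, arranged as rotation, shear, rotation to match
`frameDet_shear` and `frameDet_prodMap_smul`. -/
theorem fderiv_rootInv (n : ℤ) {q : ℂ × ℂ} (hq : q.2 ≠ 0) (v : ℂ × ℂ) :
    fderiv ℝ (rootInv n) q v =
      ((direction q.2)⁻¹ * (v.1 - (Complex.I * q.1 / (‖q.2‖ : ℂ)) *
          ((star (direction q.2) * v.2).im : ℂ)),
        direction q.2 ^ (-n) * ⟨(star (direction q.2) * v.2).re,
          (-n : ℝ) * (star (direction q.2) * v.2).im⟩) := by
  have hd := direction_ne_zero hq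
  have h0 : (‖q.2‖ : ℂ) ≠ 0 := by simpa using hq
  have hline : HasDerivAt (fun t : ℝ => (q.1 + (t : ℂ) * v.1, q.2 + (t : ℂ) * v.2)) v 0 := by
    have h1 : HasDerivAt (fun t : ℝ => q.1 + (t : ℂ) * v.1) v.1 0 := by
      simpa using ((Complex.ofRealCLM.hasDerivAt (x := (0 : ℝ))).mul_const v.1).const_add q.1
    have h2 : HasDerivAt (fun t : ℝ => q.2 + (t : ℂ) * v.2) v.2 0 := by
      simpa using ((Complex.ofRealCLM.hasDerivAt (x := (0 : ℝ))).mul_const v.2).const_add q.2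
    exact h1.prodMk h2
  have hf : HasFDerivAt (rootInv n) (fderiv ℝ (rootInv n) q)
      ((fun t : ℝ => (q.1 + (t : ℂ) * v.1, q.2 + (t : ℂ) * v.2)) 0) := by
    simpa using ((contDiffAt_rootInv n hq).differentiableAt (by simp)).hasFDerivAt
  have hA := hf.comp_hasDerivAt (0 : ℝ) hline
  have hD := hasDerivAt_direction_line (w := v.2) hq
  have hN := (hasDerivAt_norm_line (w := v.2) hq).ofReal_comp
  have h1 : HasDerivAt (fun t : ℝ => q.1 + (t : ℂ) * v.1) v.1 0 := by
    simpa using ((Complex.ofRealCLM.hasDerivAt (x := (0 : ℝ))).mul_const v.1).const_add q.1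
  have hB1 := h1.mul (hD.inv (by simpa using hd))
  have hz : HasDerivAt (fun z : ℂ => z ^ (-n)) _ (direction (q.2 + ((0 : ℝ) : ℂ) * v.2)) :=
    hasDerivAt_zpow (-n) _ (Or.inl (by simpa using hd))
  have hB2 := hN.mul (hz.comp_of_eq (0 : ℝ) hD rfl)
  have hB := hA.unique (hB1.prodMk hB2)
  rw [hB]
  simp only [Complex.ofReal_zero, zero_mul, add_zero, Function.comp_apply, Pi.inv_apply]
  set c := direction q.2
  set ρ := (star c * v.2).re
  set μ := (star c * v.2).im
  refine Prod.ext ?_ ?_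
  · push_cast
    field_simp
    ring
  · have h5 : (⟨ρ, (-n : ℝ) * μ⟩ : ℂ) = (ρ : ℂ) + (-n : ℂ) * μ * Complex.I := by
      apply Complex.ext <;> simp
    rw [h5, zpow_sub_one₀ hd]
    push_cast
    field_simp

/-- The source of the sign in the degree. The phase of the second coordinate is raised to the power
`-n`, and everything else in the derivative is a rotation or a shear of determinant one. -/
theorem paramDet_rootInv_comp (n : ℤ) {φ : E3 → ℂ × ℂ} {y : E3} (hφ : DifferentiableAt ℝ φ y)
    (hy : (φ y).2 ≠ 0) : paramDet (fun z => rootInv n (φ z)) y = -n * paramDet φ y := by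
  have hc := norm_direction hy
  set c := direction (φ y).2 with hcdef
  have hcs : star c * (φ y).2 = (‖(φ y).2‖ : ℂ) := by
    rw [← norm_mul_direction (φ y).2, ← hcdef, mul_left_comm, Complex.star_def,
      ← Complex.normSq_eq_conj_mul_self, Complex.normSq_eq_norm_sq, hc, one_pow,
      Complex.ofReal_one, mul_one, norm_mul, hc, Complex.norm_real, norm_norm, mul_one]
  have h1 : fderiv ℝ (fun z => rootInv n (φ z)) y =
      (fderiv ℝ (rootInv n) (φ y)).comp (fderiv ℝ φ y) :=
    fderiv_comp y ((contDiffAt_rootInv n hy).differentiableAt (by simp)) hφ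
  -- Euler's identity: `rootInv` is homogeneous of degree one under positive scaling, so its
  -- derivative sends the radial vector to the image point. All four rows are thus transformed by
  -- one linear map.
  have h2 : rootInv n (φ y) = ((c⁻¹ * ((φ y).1 - (Complex.I * (φ y).1 / (‖(φ y).2‖ : ℂ)) *
          ((star c * (φ y).2).im : ℂ)),
        c ^ (-n) * ⟨(star c * (φ y).2).re, (-n : ℝ) * (star c * (φ y).2).im⟩)) := by
    rw [hcs, rootInv]
    refine Prod.ext ?_ ?_
    · simp [mul_comm, hcdef]
    · have h5 : (⟨‖(φ y).2‖, 0⟩ : ℂ) = (‖(φ y).2‖ : ℂ) := rfl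
      simp [mul_comm, hcdef, h5]
  rw [paramDet, h1, h2, paramDet]
  have h3 := frameDet_prodMap_smul c⁻¹ (c ^ (-n))
    ((φ y).1 - (Complex.I * (φ y).1 / (‖(φ y).2‖ : ℂ)) * ((star c * (φ y).2).im : ℂ),
      ⟨(star c * (φ y).2).re, (-n : ℝ) * (star c * (φ y).2).im⟩)
    (fun x => ((fderiv ℝ φ y x).1 - (Complex.I * (φ y).1 / (‖(φ y).2‖ : ℂ)) *
        ((star c * (fderiv ℝ φ y x).2).im : ℂ),
      ⟨(star c * (fderiv ℝ φ y x).2).re, (-n : ℝ) * (star c * (fderiv ℝ φ y x).2).im⟩))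
  have h4 := frameDet_shear (Complex.I * (φ y).1 / (‖(φ y).2‖ : ℂ)) (-n)
    ((φ y).1, star c * (φ y).2) (fun x => ((fderiv ℝ φ y x).1, star c * (fderiv ℝ φ y x).2))
  have h5 := frameDet_prodMap_smul 1 (star c) (φ y) (fderiv ℝ φ y)
  simp only [one_mul, norm_one, one_pow, norm_star, hc] at h5
  rw [h5] at h4
  rw [h4] at h3
  simp only [norm_inv, hc, inv_one, norm_zpow, one_zpow, one_pow, one_mul] at h3
  rw [← h3]
  congr 1
  ext1 x
  rw [ContinuousLinearMap.comp_apply, fderiv_rootInv n hy]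

/-! ### The smooth structure of the surgered manifold -/

theorem coreInv_real_smul (ε : ℝ) (n : ℤ) {t : ℝ} (ht : 0 < t) (q : ℂ × ℂ) :
    coreInv ε n (t • q) = coreInv ε n q := by
  have ht' : (t : ℂ) ≠ 0 := by exact_mod_cast ht.ne'
  simp only [coreInv, Prod.smul_fst, Prod.smul_snd, Complex.real_smul, direction_mul,
    direction_ofReal ht, one_mul, mul_div_mul_left _ _ ht']

/-- Since `coreInv` is constant on rays, its derivative kills the radial direction; this separates
the outward normal from tangent vectors. -/
theorem fderiv_coreInv_self (ε : ℝ) (n : ℤ) {q : ℂ × ℂ} (hq : q.1 ≠ 0) :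
    fderiv ℝ (coreInv ε n) q q = 0 := by
  have hl : HasDerivAt (fun t : ℝ => t • q) q 1 := by
    simpa using (hasDerivAt_id (1 : ℝ)).smul_const q
  have hf : HasFDerivAt (coreInv ε n) (fderiv ℝ (coreInv ε n) q) ((fun t : ℝ => t • q) 1) := by
    simpa using ((contDiffAt_coreInv ε n hq).differentiableAt (by simp)).hasFDerivAt
  have h1 := hf.comp_hasDerivAt (1 : ℝ) hl
  have h2 : HasDerivAt (coreInv ε n ∘ fun t : ℝ => t • q) 0 1 := by
    refine (hasDerivAt_const (1 : ℝ) (coreInv ε n q)).congr_of_eventuallyEq ?_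
    filter_upwards [Ioi_mem_nhds (zero_lt_one (α := ℝ))] with t ht
    exact coreInv_real_smul ε n ht q
  exact h1.unique h2

theorem coreLift_coreInv {ε : ℝ} (hε : 0 < ε) (n : ℤ) {q : ℂ × ℂ} (hq : q ∈ S3) (hq1 : q.1 ≠ 0) :
    coreLift ε n (direction q.1) (coreInv ε n q) = q := by
  have hd := direction_ne_zero hq1
  have h : branch n (direction q.1) (direction q.1 ^ (-n)) = direction q.1 :=
    branch_self (by rw [zpow_neg, inv_inv]) (zpow_ne_zero _ hd)
  change branch n (direction q.1) (direction q.1 ^ (-n)) • coreVec ε (star (q.2 / q.1) / ε) = _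
  rw [h]
  rw [coreVec_star_div hε hq hq1, smul_smul, mul_inv_cancel₀ hd, one_smul]

theorem mk_eq_coreMap {ε : ℝ} (hε : 0 < ε) {n : ℤ} (hn : n ≠ 0) {q : S3} (hq1 : q.1.1 ≠ 0)
    {x : D2 × Circle} (hx : ((x.1 : ℂ), (x.2 : ℂ)) = coreInv ε n q) :
    Quotient.mk (lensSetoid n) q = coreMap ε hn x := by
  rw [← mk_coreLift hn (direction_ne_zero hq1) x]
  congr 1
  refine Subtype.ext ?_
  change _ = coreLift ε n (direction q.1.1) ((x.1 : ℂ), (x.2 : ℂ))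
  rw [hx, coreLift_coreInv hε n q.2 hq1]

theorem isPositiveAt_iff {φ : E3 → ℂ × ℂ} {y : E3} : IsPositiveAt φ y ↔ 0 < paramDet φ y := Iff.rfl

/-- The quotient map from the sphere to the surgered manifold. -/
def toSurgery {ε : ℝ} (hε : 0 < ε) {n : ℤ} (hn : n ≠ 0) (q : S3) : Surgery (tube ε n) :=
  (lensHomeomorph hε hn).symm (Quotient.mk (lensSetoid n) q)

section

variable {ε : ℝ} (hε : 0 < ε) {n : ℤ} (hn : n ≠ 0)

theorem isLensQuotient_toSurgery : IsLensQuotient n (toSurgery hε hn) where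
  continuous := (lensHomeomorph hε hn).symm.continuous.comp (isLensQuotient_mk hn).continuous
  isOpenMap := (lensHomeomorph hε hn).symm.isOpenMap.comp (isLensQuotient_mk hn).isOpenMap
  surjective := (lensHomeomorph hε hn).symm.surjective.comp (isLensQuotient_mk hn).surjective
  eq_iff p q := (lensHomeomorph hε hn).symm.injective.eq_iff.trans
    ((isLensQuotient_mk hn).eq_iff p q)

theorem toSurgery_rootLift {b : ℂ} (hb : b ≠ 0) (p : ↥(S3 \ unknot)) :
    toSurgery hε hn ⟨rootLift n b p.1, rootLift_mem_S3 hn hb p.2.1 (snd_ne_zero p)⟩ =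
      complementInclusion ε n p := by
  rw [toSurgery, mk_rootLift hn hb, complementInclusion_eq hε hn]
  rfl

theorem complementInclusion_rootInv (q : S3) (hq : q.1.2 ≠ 0) :
    complementInclusion ε n ⟨rootInv n q, rootInv_mem q.2 hq⟩ = toSurgery hε hn q := by
  rw [complementInclusion_eq hε hn, Function.comp_apply, iMap_rootInv hn q hq]
  rfl

theorem toSurgery_eq_inr {q : S3} {x : D2 × Circle}
    (h : Quotient.mk (lensSetoid n) q = coreMap ε hn x) :
    toSurgery hε hn q = Quot.mk _ (Sum.inr x) := by
  rw [toSurgery, h]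
  exact (lensHomeomorph hε hn).symm_apply_apply (Quot.mk _ (Sum.inr x))

theorem orientedAtlas_subset_surgeryAtlas :
    orientedAtlas (toSurgery hε hn) (-n) ⊆ surgeryAtlas ε n := by
  intro e he
  constructor
  · intro p hp
    have hp2 := snd_ne_zero p
    let q : S3 := ⟨rootLift n 1 p.1, rootLift_mem_S3 hn one_ne_zero p.2.1 hp2⟩
    have hq : toSurgery hε hn q = complementInclusion ε n p :=
      toSurgery_rootLift hε hn one_ne_zero p
    have hq2 : q.1.2 ≠ 0 := norm_ne_zero_iff.1 (by
      rw [norm_rootLift_snd hn one_ne_zero hp2]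
      exact norm_ne_zero_iff.2 hp2)
    obtain ⟨φ, ⟨hφ, hφq, hφl⟩, hφs⟩ := he q (by rwa [hq])
    rw [hq] at hφ hφq hφl hφs
    have hφ2 : (φ (e (complementInclusion ε n p))).2 ≠ 0 := by rwa [hφq]
    refine ⟨fun z => rootInv n (φ z), ⟨?_, ?_, ?_⟩, ?_⟩
    · exact ContDiffAt.comp (g := rootInv n) _ (contDiffAt_rootInv n hφ2) hφ
    · exact (congrArg (rootInv n) hφq).trans (rootInv_rootLift hn one_ne_zero hp2)
    · filter_upwards [hφl, (continuous_snd.continuousAt.comp hφ.continuousAt).eventually_ne hφ2]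
        with y ⟨x, hx, hxy⟩ hy
      simp only [Function.comp_apply, ← hx] at hy ⊢
      exact ⟨_, rfl, (complementInclusion_rootInv hε hn x hy).trans hxy⟩
    · rwa [isPositiveAt_iff, paramDet_rootInv_comp n (hφ.differentiableAt (by simp)) hφ2]
  · intro x hx hxe
    set b := branch n 1 x.2 with hbdef
    have hb1 : ‖b‖ = 1 := norm_branch hn one_ne_zero (Circle.norm_coe x.2)
    have hb0 : b ≠ 0 := norm_ne_zero_iff.1 (by simp [hb1])
    have hbn : b ^ n = (x.2 : ℂ)⁻¹ := branch_zpow hn one_ne_zero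
    have hx2 := Circle.coe_ne_zero x.2
    let q : S3 := ⟨coreLift ε n b ((x.1 : ℂ), (x.2 : ℂ)),
      coreLift_mem_S3 hn hb0 (Circle.norm_coe x.2)⟩
    have hq : toSurgery hε hn q = Quot.mk _ (Sum.inr x) :=
      toSurgery_eq_inr hε hn (mk_coreLift hn hb0 x)
    obtain ⟨φ, ⟨hφ, hφq, hφl⟩, hφs⟩ := he q (by rwa [hq])
    rw [hq] at hφ hφq hφl hφs
    set y₀ := e (Quot.mk _ (Sum.inr x)) with hy₀
    have hbb := norm_branch hn hb0 (Circle.norm_coe x.2)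
    have hq1 : q.1.1 ≠ 0 := smul_coreVec_fst_ne_zero ε hbb _
    have hφ1 : (φ y₀).1 ≠ 0 := by rwa [hφq]
    -- The point is in the open solid torus. The strict inequality persists nearby and keeps the
    -- coordinates `coreInv` in the disk.
    have hlt : ‖(φ y₀).2‖ < ε * ‖(φ y₀).1‖ := by
      rw [hφq]
      refine (norm_snd_smul_coreVec hε _ _).trans_lt ?_
      refine mul_lt_mul_of_pos_right ?_ (norm_pos_iff.2 hq1)
      simpa using mul_lt_mul_of_pos_left hx hε
    have hψ : ContDiffAt ℝ ∞ (fun z => coreInv ε n (φ z)) y₀ :=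
      ContDiffAt.comp (g := coreInv ε n) y₀ (contDiffAt_coreInv ε n hφ1) hφ
    have hψ0 : coreInv ε n (φ y₀) = ((x.1 : ℂ), (x.2 : ℂ)) := by
      rw [hφq]
      exact coreInv_coreLift hε hn hb0 (Circle.norm_coe x.2)
    have hloc : ∀ᶠ y in 𝓝 y₀, ∃ (q' : S3) (x' : D2 × Circle), q'.1 = φ y ∧
        toSurgery hε hn q' = e.symm y ∧ ((x'.1 : ℂ), (x'.2 : ℂ)) = coreInv ε n (φ y) ∧
        Quotient.mk (lensSetoid n) q' = coreMap ε hn x' := by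
      have hc := hφ.continuousAt
      have h1 : ContinuousAt (fun y => ‖(φ y).2‖) y₀ := by fun_prop
      have h2 : ContinuousAt (fun y => ε * ‖(φ y).1‖) y₀ := by fun_prop
      filter_upwards [hφl, h1.eventually_lt h2 hlt] with y ⟨q', hq', hqy⟩ hy
      have hq1' : q'.1.1 ≠ 0 := fst_ne_zero_of_norm_lt (by rwa [hq'])
      have hle : ‖star (q'.1.2 / q'.1.1) / (ε : ℂ)‖ ≤ 1 := by
        rw [norm_div, norm_star, norm_div, Complex.norm_real, Real.norm_of_nonneg hε.le, div_div]
        rw [← hq'] at hy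
        exact div_le_one_of_le₀ (by linarith) (by positivity)
      let x' : D2 × Circle := (⟨_, mem_closedBall_zero_iff.2 hle⟩,
        ⟨direction q'.1.1 ^ (-n), by simp [Submonoid.unitSphere, norm_direction hq1']⟩)
      have hx' : ((x'.1 : ℂ), (x'.2 : ℂ)) = coreInv ε n q' := rfl
      exact ⟨q', x', hq', hqy, by rw [hx', hq'], mk_eq_coreMap hε hn hq1' hx'⟩
    refine ⟨fun z => coreInv ε n (φ z), ⟨hψ, hψ0, ?_⟩, ?_⟩
    · filter_upwards [hloc] with y ⟨q', x', hq', hqy, hx', hm⟩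
      exact ⟨x', hx', by rw [← hqy, toSurgery_eq_inr hε hn hm]⟩
    · have hK : ContDiffAt ℝ ∞ (coreLift ε n b) (coreInv ε n (φ y₀)) := by
        rw [hψ0]
        exact contDiffAt_coreLift ε hbn hx2
      -- Since `φ` factors through `coreInv ∘ φ`, injectivity of its derivative passes to that of
      -- `coreInv ∘ φ`.
      have heq : φ =ᶠ[𝓝 y₀] coreLift ε n b ∘ fun z => coreInv ε n (φ z) := by
        refine eventuallyEq_of_orbit hn
          (ContinuousAt.comp (g := coreLift ε n b) hK.continuousAt hψ.continuousAt)
          hφ.continuousAt ?_ ?_ ?_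
        · rw [Function.comp_apply, hψ0, hφq]
        · rw [Function.comp_apply, hψ0]
          exact S3_ne_zero q.2
        · filter_upwards [hloc] with y ⟨q', x', hq', hqy, hx', hm⟩
          rw [← mk_coreLift hn hb0 x'] at hm
          obtain ⟨k, hk⟩ := Quotient.exact hm.symm
          refine ⟨k, ?_⟩
          rw [Function.comp_apply, ← hx', ← hq', hk]
      have hne : paramDet φ y₀ ≠ 0 := fun h => by simp [h] at hφs
      have hinj := injective_fderiv_of_paramDet_ne_zero hne
      rw [heq.fderiv_eq, fderiv_comp y₀ (hK.differentiableAt (by simp))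
        (hψ.differentiableAt (by simp))] at hinj
      exact Function.Injective.of_comp hinj

theorem exists_lift_of_snd_ne_zero {e : OpenPartialHomeomorph (Surgery (tube ε n)) E3}
    (he : e ∈ surgeryAtlas ε n) {q : S3} (hq : toSurgery hε hn q ∈ e.source) (hq2 : q.1.2 ≠ 0) :
    ∃ φ, IsSmoothLiftAt Subtype.val (toSurgery hε hn) e q φ ∧
      0 < (-n : ℝ) * paramDet φ (e (toSurgery hε hn q)) := by
  have hd := direction_ne_zero hq2
  let p : ↥(S3 \ unknot) := ⟨rootInv n q, rootInv_mem q.2 hq2⟩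
  have hp : complementInclusion ε n p = toSurgery hε hn q := complementInclusion_rootInv hε hn q hq2
  have hbn : direction q.1.2 ^ n = (direction p.1.2)⁻¹ := by
    change _ = (direction (rootInv n q).2)⁻¹
    rw [rootInv, direction_mul, direction_ofReal (norm_pos_iff.2 hq2), one_mul,
      direction_eq_self (z := direction q.1.2 ^ (-n))
        (by rw [norm_zpow, norm_direction hq2, one_zpow]), zpow_neg, inv_inv]
  have hpq : rootLift n (direction q.1.2) p.1 = q := by
    rw [rootLift, branch_self hbn (direction_ne_zero (snd_ne_zero p)), norm_rootInv_snd hq2]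
    refine Prod.ext ?_ ?_
    · simp only [p, rootInv, Prod.smul_fst, smul_eq_mul]
      field_simp
    · simp only [Prod.smul_snd, smul_eq_mul]
      rw [mul_comm, norm_mul_direction]
  obtain ⟨φ, ⟨hφ, hφp, hφl⟩, hφs⟩ := he.1 p (by rwa [hp])
  rw [hp] at hφ hφp hφl hφs
  have hψ : ContDiffAt ℝ ∞ (fun z => rootLift n (direction q.1.2) (φ z))
      (e (toSurgery hε hn q)) := by
    refine ContDiffAt.comp (g := rootLift n (direction q.1.2)) _ ?_ hφ
    rw [hφp]
    exact contDiffAt_rootLift (snd_ne_zero p) hbn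
  refine ⟨fun z => rootLift n (direction q.1.2) (φ z), ⟨hψ, ?_, ?_⟩, ?_⟩
  · exact (congrArg _ hφp).trans hpq
  · filter_upwards [hφl] with y ⟨x, hx, hxy⟩
    rw [← hx, ← hxy]
    exact ⟨_, rfl, toSurgery_rootLift hε hn hd x⟩
  -- Applying `rootInv` to the new lift gives back the old positive lift `φ`, so the sign is read
  -- off from the factor `-n`.
  · rw [← paramDet_rootInv_comp n (hψ.differentiableAt (by simp)) (by rwa [hφp, hpq])]
    have heq : φ =ᶠ[𝓝 (e (toSurgery hε hn q))]
        fun z => rootInv n (rootLift n (direction q.1.2) (φ z)) := by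
      filter_upwards [hφl] with y ⟨x, hx, hxy⟩
      rw [← hx, rootInv_rootLift hn hd (snd_ne_zero x)]
    rwa [isPositiveAt_iff, paramDet, heq.fderiv_eq, heq.self_of_nhds] at hφs

/-- At the core a chart of `surgeryAtlas` is only required to be immersive, so the orientation is
inherited by continuity: the determinant is nonzero here and has the right sign at nearby points off
the core. -/
theorem exists_lift_of_snd_eq_zero {e : OpenPartialHomeomorph (Surgery (tube ε n)) E3}
    (he : e ∈ surgeryAtlas ε n) {q : S3} (hq : toSurgery hε hn q ∈ e.source) (hq2 : q.1.2 = 0) :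
    ∃ φ, IsSmoothLiftAt Subtype.val (toSurgery hε hn) e q φ ∧
      0 < (-n : ℝ) * paramDet φ (e (toSurgery hε hn q)) := by
  have hq1 : q.1.1 ≠ 0 := fun h => S3_ne_zero q.2 (Prod.ext h hq2)
  have hd := direction_ne_zero hq1
  set b := direction q.1.1 with hbdef
  let x : D2 × Circle := (center,
    ⟨b ^ (-n), by simp [Submonoid.unitSphere, hbdef, norm_direction hq1]⟩)
  have hxq : ((x.1 : ℂ), (x.2 : ℂ)) = coreInv ε n q := by
    refine Prod.ext ?_ rfl
    simp [x, center, coreInv, hq2]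
  have hx : toSurgery hε hn q = Quot.mk _ (Sum.inr x) :=
    toSurgery_eq_inr hε hn (mk_eq_coreMap hε hn hq1 hxq)
  have hbn : b ^ n = (x.2 : ℂ)⁻¹ := by
    change _ = (b ^ (-n))⁻¹
    rw [zpow_neg, inv_inv]
  obtain ⟨φ, ⟨hφ, hφx, hφl⟩, hφi⟩ := he.2 x (by simp [x, center]) (by rwa [← hx])
  simp only [← hx] at hφ hφx hφl hφi
  set y₀ := e (toSurgery hε hn q) with hy₀
  have hK : ContDiffAt ℝ ∞ (coreLift ε n b) (φ y₀) := by
    rw [hφx]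
    exact contDiffAt_coreLift ε hbn (Circle.coe_ne_zero x.2)
  have hψ : ContDiffAt ℝ ∞ (fun z => coreLift ε n b (φ z)) y₀ :=
    ContDiffAt.comp (g := coreLift ε n b) _ hK hφ
  have hψ0 : coreLift ε n b (φ y₀) = q := by
    rw [hφx, hxq, coreLift_coreInv hε n q.2 hq1]
  have hψl : ∀ᶠ y in 𝓝 y₀, ∃ q' : S3, q'.1 = coreLift ε n b (φ y) ∧
      toSurgery hε hn q' = e.symm y := by
    filter_upwards [hφl] with y ⟨x', hx', hxy⟩
    rw [← hx', ← hxy]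
    exact ⟨_, rfl, toSurgery_eq_inr hε hn (mk_coreLift hn hd x')⟩
  -- `coreInv` undoes the lift and kills the radial vector, so a relation between that vector and
  -- the image of the derivative has no tangential part, and then no radial part.
  have hdet : paramDet (fun z => coreLift ε n b (φ z)) y₀ ≠ 0 := by
    have heq : φ =ᶠ[𝓝 y₀] coreInv ε n ∘ fun z => coreLift ε n b (φ z) := by
      filter_upwards [hφl] with y ⟨x', hx', hxy⟩
      rw [Function.comp_apply, ← hx', coreInv_coreLift hε hn hd (Circle.norm_coe x'.2)]
    have hH : ContDiffAt ℝ ∞ (coreInv ε n) (coreLift ε n b (φ y₀)) := by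
      rw [hψ0]
      exact contDiffAt_coreInv ε n hq1
    rw [heq.fderiv_eq, fderiv_comp y₀ (hH.differentiableAt (by simp))
      (hψ.differentiableAt (by simp))] at hφi
    rw [paramDet, frameDet_ne_zero_iff]
    intro l v hlv
    have h1 := congrArg (fderiv ℝ (coreInv ε n) (coreLift ε n b (φ y₀))) hlv
    have h2 : fderiv ℝ (coreInv ε n) (coreLift ε n b (φ y₀)) (coreLift ε n b (φ y₀)) = 0 := by
      rw [hψ0]
      exact fderiv_coreInv_self ε n hq1
    rw [map_add, map_smul, h2, smul_zero, zero_add, map_zero] at h1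
    have hv : v = 0 := hφi (by
      rw [ContinuousLinearMap.comp_apply, h1, map_zero])
    rw [hv, map_zero, add_zero, hψ0] at hlv
    exact ⟨(smul_eq_zero.1 hlv).resolve_right (S3_ne_zero q.2), hv⟩
  -- If the lift stayed in the circle `v = 0` near `y₀`, its derivative would too, and the
  -- determinant would vanish.
  have hfreq : ∃ᶠ y in 𝓝 y₀, (coreLift ε n b (φ y)).2 ≠ 0 := by
    intro hev
    apply hdet
    have h0 : (fun y => (coreLift ε n b (φ y)).2) =ᶠ[𝓝 y₀] fun _ => 0 := by
      filter_upwards [hev] with y hy using not_not.1 hy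
    have h1 : ∀ v, (fderiv ℝ (fun z => coreLift ε n b (φ z)) y₀ v).2 = 0 := by
      intro v
      have h2 := (hψ.differentiableAt (by simp)).hasFDerivAt.snd
      have h3 := h2.fderiv.symm.trans (h0.fderiv_eq.trans (fderiv_const_apply 0))
      exact DFunLike.congr_fun h3 v
    simp [paramDet, frameDet, orientationDet_apply, h1, h0.self_of_nhds]
  have hev : ∀ᶠ y in 𝓝 y₀, (coreLift ε n b (φ y)).2 ≠ 0 →
      0 < (-n : ℝ) * paramDet (fun z => coreLift ε n b (φ z)) y := by
    -- Smoothness of order `∞` at a point need not persist on a neighborhood, but finite order does;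
    -- only continuity is needed.
    have hC1 : ∀ᶠ y in 𝓝 y₀, ContDiffAt ℝ 1 (fun z => coreLift ε n b (φ z)) y :=
      (hψ.of_le (by exact_mod_cast le_top)).eventually (by simp)
    filter_upwards [hC1, eventually_eventually_nhds.2 hψl,
      e.open_target.mem_nhds (e.map_source hq)] with y hy hyl hyt hy2
    obtain ⟨q', hq', hqy⟩ := hyl.self_of_nhds
    obtain ⟨φ', ⟨hφ', hφq', hφl'⟩, hφs'⟩ := exists_lift_of_snd_ne_zero hε hn he (q := q')
      (by rw [hqy]; exact e.map_target hyt) (by rwa [hq'])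
    rw [hqy, e.right_inv hyt] at hφ' hφq' hφl' hφs'
    have heq : (fun z => coreLift ε n b (φ z)) =ᶠ[𝓝 y] φ' := by
      refine eventuallyEq_of_orbit hn hφ'.continuousAt hy.continuousAt
        (hq'.symm.trans hφq'.symm) (hφq' ▸ S3_ne_zero q'.2) ?_
      filter_upwards [hyl, hφl'] with z ⟨q₁, h1, h2⟩ ⟨q₂, h3, h4⟩
      obtain ⟨k, hk⟩ := ((isLensQuotient_toSurgery hε hn).eq_iff q₂ q₁).1 (h4.trans h2.symm)
      exact ⟨k, by rw [← h1, hk, h3]⟩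
    rwa [paramDet, heq.fderiv_eq, show coreLift ε n b (φ y) = φ' y from heq.self_of_nhds]
  refine ⟨_, ⟨hψ, hψ0, hψl⟩, ?_⟩
  have hge : 0 ≤ (-n : ℝ) * paramDet (fun z => coreLift ε n b (φ z)) y₀ := by
    refine ge_of_tendsto_of_frequently
      ((continuousAt_const.mul (continuousAt_paramDet hψ)).tendsto) ?_
    exact (hfreq.and_eventually hev).mono fun y hy => (hy.2 hy.1).le
  refine lt_of_le_of_ne hge (mul_ne_zero ?_ hdet).symm
  exact neg_ne_zero.2 (by exact_mod_cast hn)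

/-- Reduces all statements about the surgered manifold to the general theory of oriented quotients
of the sphere. -/
theorem surgeryAtlas_eq : surgeryAtlas ε n = orientedAtlas (toSurgery hε hn) (-n) := by
  refine Set.Subset.antisymm (fun e he q hq => ?_) (orientedAtlas_subset_surgeryAtlas hε hn)
  by_cases hq2 : q.1.2 = 0
  · exact exists_lift_of_snd_eq_zero hε hn he hq hq2
  · exact exists_lift_of_snd_ne_zero hε hn he hq hq2

theorem isClosedOrientedManifold_surgeryAtlas {ε : ℝ} (hε : 0 < ε) {n : ℤ} (hn : n ≠ 0) :
    IsClosedOrientedManifold (surgeryAtlas ε n) := by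
  rw [surgeryAtlas_eq hε hn]
  exact (isLensQuotient_toSurgery hε hn).isClosedOrientedManifold hn
    (neg_ne_zero.2 (by exact_mod_cast hn))

end

/-! ### The degree of the extension of `i_n` -/

theorem quotientAtlas_eq (s : Setoid S3) : quotientAtlas s = orientedAtlas (Quotient.mk s) 1 := by
  simp only [orientedAtlas, one_mul]
  rfl

theorem isClosedOrientedManifold_quotientAtlas {n : ℤ} (hn : n ≠ 0) :
    IsClosedOrientedManifold (quotientAtlas (lensSetoid n)) := by
  rw [quotientAtlas_eq]
  exact (isLensQuotient_mk hn).isClosedOrientedManifold hn one_ne_zero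

theorem hasDegree_of_extends {ε : ℝ} (hε : 0 < ε) {n : ℤ} (hn : n ≠ 0)
    (Φ : Surgery (tube ε n) ≃ₜ Lens n) (hΦ : ∀ p, Φ (complementInclusion ε n p) = iMap n p) :
    HasDegree (surgeryAtlas ε n) (quotientAtlas (lensSetoid n)) ⟨Φ, Φ.continuous⟩ (-n.sign) := by
  obtain rfl := (existsUnique_homeomorph hε hn).unique hΦ (lensHomeomorph_complementInclusion hε hn)
  rw [quotientAtlas_eq, surgeryAtlas_eq hε hn]
  refine hasDegree_of_lift hn (isLensQuotient_toSurgery hε hn) (isLensQuotient_mk hn) _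
    (fun q => (lensHomeomorph hε hn).apply_symm_apply _) ?_
  rcases hn.lt_or_gt with h | h
  · left
    rw [Int.sign_eq_neg_one_of_neg h]
    exact ⟨rfl, by simpa using (Int.cast_lt (R := ℝ)).2 h⟩
  · right
    rw [Int.sign_eq_one_of_pos h]
    exact ⟨rfl, by simpa using (Int.cast_lt (R := ℝ)).2 h⟩

/-! ### The tube is a framed tubular neighborhood -/

/-- A smooth left inverse of the tube. -/
def tubeInv (ε : ℝ) (n : ℤ) (p : ℂ × ℂ) : ℂ × ℂ :=
  (direction p.1, p.2 * p.1⁻¹ * (ε : ℂ)⁻¹ * direction p.1 ^ (1 - n))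

/-- The smooth extension of the tube. -/
def tubeExt (ε : ℝ) (n : ℤ) (x : ℂ × ℂ) : ℂ × ℂ := (euclNorm (tubeVec ε n x))⁻¹ • tubeVec ε n x

theorem tubeInv_tubeExt {ε : ℝ} (hε : 0 < ε) (n : ℤ) {x : ℂ × ℂ} (hx : ‖x.1‖ = 1) :
    tubeInv ε n (tubeExt ε n x) = x := by
  have hx0 : x.1 ≠ 0 := norm_ne_zero_iff.1 (by simp [hx])
  have hε' : (ε : ℂ) ≠ 0 := by exact_mod_cast hε.ne'
  have hN := inv_pos.2 (euclNorm_pos (tubeVec_ne_zero ε n hx0))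
  have hN' : (((euclNorm (tubeVec ε n x))⁻¹ : ℝ) : ℂ) ≠ 0 := by exact_mod_cast hN.ne'
  have hd : direction (tubeExt ε n x).1 = x.1 := by
    rw [tubeExt, Prod.smul_fst, Complex.real_smul, direction_mul, direction_ofReal hN, one_mul]
    exact direction_eq_self hx
  refine Prod.ext hd ?_
  rw [tubeInv, hd]
  simp only [tubeExt, tubeVec, Prod.smul_fst, Prod.smul_snd, Complex.real_smul] at hN' ⊢
  rw [zpow_sub₀ hx0, zpow_one]
  have h3 := zpow_ne_zero n hx0
  rw [mul_inv]
  generalize (((euclNorm (x.1, (ε : ℂ) * x.2 * x.1 ^ n))⁻¹ : ℝ) : ℂ) = N at *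
  field_simp

theorem contDiffAt_tubeVec (ε : ℝ) (n : ℤ) {x : ℂ × ℂ} (hx : x.1 ≠ 0) :
    ContDiffAt ℝ ∞ (tubeVec ε n) x := by
  have h1 : ContDiffAt ℝ ∞ (fun x : ℂ × ℂ => x.1 ^ n) x :=
    ContDiffAt.comp (g := fun z : ℂ => z ^ n) x (contDiffAt_zpow_real n hx) contDiffAt_fst
  exact contDiffAt_fst.prodMk ((contDiffAt_const.mul contDiffAt_snd).mul h1)

theorem contDiffAt_tubeExt (ε : ℝ) (n : ℤ) {x : ℂ × ℂ} (hx : x.1 ≠ 0) :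
    ContDiffAt ℝ ∞ (tubeExt ε n) x := by
  have h := contDiffAt_tubeVec ε n hx
  exact (ContDiffAt.comp (g := fun w => (euclNorm w)⁻¹) (f := tubeVec ε n) x
    (contDiffAt_inv_euclNorm (tubeVec_ne_zero ε n hx)) h).smul h

theorem contDiffAt_tubeInv (ε : ℝ) (n : ℤ) {p : ℂ × ℂ} (hp : p.1 ≠ 0) :
    ContDiffAt ℝ ∞ (tubeInv ε n) p := by
  have hd : ContDiffAt ℝ ∞ (fun p : ℂ × ℂ => direction p.1) p :=
    (contDiffAt_direction hp).comp p contDiffAt_fst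
  have h1 : ContDiffAt ℝ ∞ (fun p : ℂ × ℂ => direction p.1 ^ (1 - n)) p :=
    ContDiffAt.comp (g := fun z : ℂ => z ^ (1 - n)) (f := fun p : ℂ × ℂ => direction p.1) p
      (contDiffAt_zpow_real _ (direction_ne_zero hp)) hd
  exact hd.prodMk (((contDiffAt_snd.mul (contDiffAt_fst.inv hp)).mul contDiffAt_const).mul h1)

theorem tubeExt_fst_ne_zero (ε : ℝ) (n : ℤ) {x : ℂ × ℂ} (hx : x.1 ≠ 0) :
    (tubeExt ε n x).1 ≠ 0 := by
  rw [tubeExt, Prod.smul_fst, Complex.real_smul]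
  refine mul_ne_zero ?_ hx
  exact_mod_cast (inv_pos.2 (euclNorm_pos (tubeVec_ne_zero ε n hx))).ne'

theorem isEmbedding_tube {ε : ℝ} (hε : 0 < ε) (n : ℤ) : Topology.IsEmbedding (tube ε n) := by
  have : CompactSpace D2 := isCompact_iff_compactSpace.1 (isCompact_closedBall 0 1)
  have hc : Continuous (tube ε n) := by
    rw [Topology.IsInducing.subtypeVal.continuous_iff]
    have h : (Subtype.val ∘ tube ε n) = fun x => tubeExt ε n ((x.1 : ℂ), (x.2 : ℂ)) :=
      funext fun x => tube_val ε n x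
    rw [h, continuous_iff_continuousAt]
    intro x
    exact ContinuousAt.comp (g := tubeExt ε n)
      (f := fun x : Circle × D2 => ((x.1 : ℂ), (x.2 : ℂ)))
      (contDiffAt_tubeExt ε n (Circle.coe_ne_zero x.1)).continuousAt (by fun_prop)
  refine (hc.isClosedEmbedding fun x x' h => ?_).isEmbedding
  have h1 : tubeExt ε n ((x.1 : ℂ), (x.2 : ℂ)) = tubeExt ε n ((x'.1 : ℂ), (x'.2 : ℂ)) :=
    (tube_val ε n x).symm.trans ((congrArg Subtype.val h).trans (tube_val ε n x'))
  have h2 := congrArg (tubeInv ε n) h1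
  rw [tubeInv_tubeExt hε n (Circle.norm_coe x.1), tubeInv_tubeExt hε n (Circle.norm_coe x'.1)] at h2
  exact Prod.ext (Circle.ext (congrArg Prod.fst h2)) (Subtype.ext (congrArg Prod.snd h2))

/-- `tubeInv` is a left inverse only over the unit circle, so the chain rule is applied along a
curve `c` that stays in `S¹ × ℂ` and has the given velocity. -/
theorem tubeExt_immersion {ε : ℝ} (hε : 0 < ε) (n : ℤ) (z : Circle) (w : ℂ) (a : ℝ) (b : ℂ)
    (h : fderiv ℝ (tubeExt ε n) ((z : ℂ), w) (a * Complex.I * z, b) = 0) : a = 0 ∧ b = 0 := by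
  have hz := Circle.coe_ne_zero z
  let c : ℝ → ℂ × ℂ := fun t => (Complex.exp (t * (a * Complex.I)) * z, w + t * b)
  have hc0 : c 0 = ((z : ℂ), w) := by simp [c]
  have hc : HasDerivAt c (a * Complex.I * z, b) 0 := by
    have h1 : HasDerivAt (fun t : ℝ => w + (t : ℂ) * b) b 0 := by
      simpa using ((Complex.ofRealCLM.hasDerivAt (x := (0 : ℝ))).mul_const b).const_add w
    have h2 : HasDerivAt (fun t : ℝ => Complex.exp (t * (a * Complex.I)) * z)
        (a * Complex.I * z) 0 := by
      simpa using (((Complex.ofRealCLM.hasDerivAt (x := (0 : ℝ))).mul_const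
        ((a : ℂ) * Complex.I)).cexp).mul_const (z : ℂ)
    exact h2.prodMk h1
  have hJ : HasFDerivAt (tubeExt ε n) (fderiv ℝ (tubeExt ε n) ((z : ℂ), w)) (c 0) := by
    rw [hc0]
    exact ((contDiffAt_tubeExt ε n hz).differentiableAt (by simp)).hasFDerivAt
  have hR : HasFDerivAt (tubeInv ε n) (fderiv ℝ (tubeInv ε n) (tubeExt ε n (c 0)))
      ((tubeExt ε n ∘ c) 0) := by
    refine ((contDiffAt_tubeInv ε n (tubeExt_fst_ne_zero ε n ?_)).differentiableAt
      (by simp)).hasFDerivAt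
    rwa [hc0]
  have h3 := hR.comp_hasDerivAt (0 : ℝ) (hJ.comp_hasDerivAt (0 : ℝ) hc)
  have h4 : (tubeInv ε n ∘ tubeExt ε n ∘ c) = c := by
    funext t
    refine tubeInv_tubeExt hε n ?_
    have : ((t : ℂ) * (a * Complex.I)) = ((t * a : ℝ) : ℂ) * Complex.I := by push_cast; ring
    rw [show (c t).1 = Complex.exp (t * (a * Complex.I)) * z from rfl, norm_mul, Circle.norm_coe,
      this, Complex.norm_exp_ofReal_mul_I, mul_one]
  rw [h4, h, map_zero] at h3
  have h5 := hc.unique h3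
  refine ⟨?_, congrArg Prod.snd h5⟩
  have h6 : (a : ℂ) * Complex.I * z = 0 := congrArg Prod.fst h5
  simpa [hz, Complex.I_ne_zero] using h6

/-! ### The linking number -/

/-- The inverse stereographic projection, a disk in the sphere that bounds the unknot. -/
def spanningDisk (a : ℂ) : ℂ × ℂ :=
  (((2 * (1 + ‖a‖ ^ 2)⁻¹ : ℝ) : ℂ) * a, ((2 * (1 + ‖a‖ ^ 2)⁻¹ - 1 : ℝ) : ℂ))

theorem contDiff_spanningDisk : ContDiff ℝ ∞ spanningDisk := by
  have h : ContDiff ℝ ∞ fun a : ℂ => (2 * (1 + ‖a‖ ^ 2)⁻¹ : ℝ) := by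
    refine contDiff_const.mul (ContDiff.inv (contDiff_const.add (contDiff_norm_sq ℝ)) fun a => ?_)
    positivity
  exact ((Complex.ofRealCLM.contDiff.comp h).mul contDiff_id).prodMk
    (Complex.ofRealCLM.contDiff.comp (h.sub contDiff_const))

theorem spanningDisk_mem_S3 (a : ℂ) : spanningDisk a ∈ S3 := by
  change ‖(spanningDisk a).1‖ ^ 2 + ‖(spanningDisk a).2‖ ^ 2 = 1
  have h : (0 : ℝ) < 1 + ‖a‖ ^ 2 := by positivity
  rw [spanningDisk, norm_mul, Complex.norm_real, Complex.norm_real, mul_pow, Real.norm_eq_abs,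
    Real.norm_eq_abs,
    sq_abs, sq_abs]
  field_simp
  ring

theorem fderiv_spanningDisk (a v : ℂ) : fderiv ℝ spanningDisk a v =
    (((2 * (1 + ‖a‖ ^ 2)⁻¹ : ℝ) : ℂ) * v -
      ((4 * ((1 + ‖a‖ ^ 2)⁻¹) ^ 2 * (a.re * v.re + a.im * v.im) : ℝ) : ℂ) * a,
      ((-4 * ((1 + ‖a‖ ^ 2)⁻¹) ^ 2 * (a.re * v.re + a.im * v.im) : ℝ) : ℂ)) := by
  have hl : HasDerivAt (fun t : ℝ => a + (t : ℂ) * v) v 0 := by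
    simpa using ((Complex.ofRealCLM.hasDerivAt (x := (0 : ℝ))).mul_const v).const_add a
  have hf : HasFDerivAt spanningDisk (fderiv ℝ spanningDisk a)
      ((fun t : ℝ => a + (t : ℂ) * v) 0) := by
    simpa using (contDiff_spanningDisk.differentiable (by simp) a).hasFDerivAt
  have hA := hf.comp_hasDerivAt (0 : ℝ) hl
  have h0 : (1 + ‖a‖ ^ 2 : ℝ) ≠ 0 := by positivity
  have hc := (((hl.norm_sq).const_add 1).inv (by simpa using h0)).const_mul 2
  have hB := ((hc.ofReal_comp).mul hl).prodMk ((hc.sub_const 1).ofReal_comp)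
  rw [hA.unique hB]
  simp only [Complex.ofReal_zero, zero_mul, add_zero, Complex.inner]
  have hre : (v * (starRingEnd ℂ) a).re = a.re * v.re + a.im * v.im := by
    simp
    ring
  refine Prod.ext ?_ ?_
  · simp only [hre, Pi.inv_apply, Complex.ofReal_zero, zero_mul, add_zero]
    push_cast
    field_simp
    ring
  · simp only [hre]
    congr 1
    field_simp
    ring

/-- The disk lies in the great sphere `Im v = 0`, so only the component of the velocity across it
contributes, with a positive conformal factor. -/
theorem orientationDet_spanningDisk (a : ℂ) (v : ℂ × ℂ) :
    orientationDet (spanningDisk a) (fderiv ℝ spanningDisk a 1)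
      (fderiv ℝ spanningDisk a Complex.I) v = 4 * ((1 + ‖a‖ ^ 2)⁻¹) ^ 2 * v.2.im := by
  have h : (1 + ‖a‖ ^ 2)⁻¹ * (1 + (a.re * a.re + a.im * a.im)) = 1 := by
    rw [← Complex.normSq_apply, Complex.normSq_eq_norm_sq]
    exact inv_mul_cancel₀ (by positivity)
  simp only [orientationDet_apply, fderiv_spanningDisk, spanningDisk]
  generalize (1 + ‖a‖ ^ 2)⁻¹ = c at *
  simp only [Complex.sub_re, Complex.sub_im, Complex.re_ofReal_mul, Complex.im_ofReal_mul,
    Complex.ofReal_re, Complex.ofReal_im, Complex.one_re, Complex.one_im, Complex.I_re,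
    Complex.I_im]
  linear_combination (exp := 1) (8 * c ^ 2 * v.2.im) * h

theorem tube_one_val (ε : ℝ) (n : ℤ) (z : Circle) : (tube ε n (z, toDisk 1)).1 =
    (((√(1 + ε ^ 2) : ℝ) : ℂ)⁻¹ * (z : ℂ), ((√(1 + ε ^ 2) : ℝ) : ℂ)⁻¹ * ((ε : ℂ) * (z :
      ℂ) ^ n)) := by
  rw [tube_val, euclNorm_tubeVec]
  simp only [tubeVec, toDisk, Circle.coe_one, mul_one, Complex.norm_real, Real.norm_eq_abs, sq_abs]
  refine Prod.ext ?_ ?_ <;> simp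

theorem velocity_tube_one (ε : ℝ) (n : ℤ) (z : Circle) :
    velocity (fun z => tube ε n (z, toDisk 1)) z =
      (((√(1 + ε ^ 2) : ℝ) : ℂ)⁻¹ * ((z : ℂ) * Complex.I),
        ((√(1 + ε ^ 2) : ℝ) : ℂ)⁻¹ * ((ε : ℂ) * ((z : ℂ) ^ n * ((n : ℂ) * Complex.I)))) := by
  have hexp : ∀ m : ℤ, HasDerivAt (fun θ : ℝ => Complex.exp (m * (θ * Complex.I)))
      (m * Complex.I) 0 := by
    intro m
    simpa using ((((Complex.ofRealCLM.hasDerivAt (x := (0 : ℝ))).mul_const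
      Complex.I).const_mul (m : ℂ))).cexp
  have h1 := (hexp 1).const_mul (z : ℂ) |>.const_mul (((√(1 + ε ^ 2) : ℝ) : ℂ)⁻¹)
  have h2 := ((hexp n).const_mul ((z : ℂ) ^ n)).const_mul (ε : ℂ) |>.const_mul
    (((√(1 + ε ^ 2) : ℝ) : ℂ)⁻¹)
  have h3 := (h1.prodMk h2).deriv
  rw [velocity]
  simp only [tube_one_val, Circle.coe_mul, Circle.coe_exp, mul_zpow, ← Complex.exp_int_mul]
  simpa using h3

theorem hasLinkingNumber_tube {ε : ℝ} (hε : 0 < ε) {n : ℤ} (hn : n ≠ 0) :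
    HasLinkingNumber (fun z => tube ε n (z, center)) (fun z => tube ε n (z, toDisk 1)) n := by
  have hcore : ∀ z : Circle, (tube ε n (z, center)).1 = ((z : ℂ), 0) := by
    intro z
    rw [tube_val, euclNorm_tubeVec]
    simp [tubeVec, center]
  have hε' : (ε : ℂ) ≠ 0 := by exact_mod_cast hε.ne'
  set s := √(1 + ε ^ 2) with hs
  have hs2 : s ^ 2 = 1 + ε ^ 2 := Real.sq_sqrt (by positivity)
  have hs0 : 0 < s := Real.sqrt_pos.2 (by positivity)
  have hsC : (s : ℂ) ≠ 0 := by exact_mod_cast hs0.ne'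
  have hse : 0 < s + ε := by positivity
  have hseC : (s : ℂ) + ε ≠ 0 := by exact_mod_cast hse.ne'
  have hpt : ∀ (a : ℂ) (z : Circle), a ∈ Metric.closedBall (0 : ℂ) 1 ∧
      spanningDisk a = (tube ε n (z, toDisk 1)).1 ↔ (z : ℂ) ^ n = 1 ∧ a = z / (s + ε) := by
    intro a z
    have hz := Circle.norm_coe z
    rw [tube_one_val, ← hs, spanningDisk, Prod.mk.injEq]
    constructor
    · rintro ⟨ha, h1, h2⟩
      rw [mem_closedBall_zero_iff] at ha
      -- On the closed disk the second coordinate is nonnegative; this excludes the intersections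
      -- with `zⁿ = -1`, which lie on the opposite hemisphere.
      have hc : 1 ≤ 2 * (1 + ‖a‖ ^ 2)⁻¹ := by
        rw [← div_eq_mul_inv, one_le_div (by positivity)]
        nlinarith [norm_nonneg a]
      set c := 2 * (1 + ‖a‖ ^ 2)⁻¹
      have h3 : c - 1 = s⁻¹ * ε := by
        have := congrArg norm h2
        rwa [Complex.norm_real, Real.norm_of_nonneg (by linarith), norm_mul, norm_mul, norm_inv,
          norm_zpow, hz, one_zpow, mul_one, Complex.norm_real, Complex.norm_real,
          Real.norm_of_nonneg hs0.le, Real.norm_of_nonneg hε.le] at this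
      have h4 : (z : ℂ) ^ n = 1 := by
        rw [h3] at h2
        push_cast at h2
        field_simp at h2
        exact h2.symm
      refine ⟨h4, ?_⟩
      have h5 : c = (s + ε) / s := by
        field_simp
        field_simp at h3
        linarith
      rw [h5] at h1
      push_cast at h1
      field_simp at h1 ⊢
      linear_combination h1
    · rintro ⟨h4, rfl⟩
      have hna : ‖(z : ℂ) / (s + ε)‖ = (s + ε)⁻¹ := by
        rw [norm_div, hz, ← Complex.ofReal_add, Complex.norm_real, Real.norm_of_nonneg hse.le,
          one_div]
      have hc : 2 * (1 + ‖(z : ℂ) / (s + ε)‖ ^ 2)⁻¹ = (s + ε) / s := by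
        rw [hna]
        have : (0 : ℝ) < (s + ε) ^ 2 + 1 := by positivity
        field_simp
        nlinarith
      refine ⟨?_, ?_, ?_⟩
      · rw [mem_closedBall_zero_iff, hna]
        refine inv_le_one_of_one_le₀ ?_
        nlinarith
      · rw [hc]
        push_cast
        field_simp
      · rw [hc, h4]
        push_cast
        field_simp
        ring
  -- At an intersection the second coordinate of the curve moves with velocity a positive multiple
  -- of `n i`.
  have hdet : ∀ (a : ℂ) (z : Circle), (z : ℂ) ^ n = 1 →
      orientationDet (spanningDisk a) (fderiv ℝ spanningDisk a 1)
        (fderiv ℝ spanningDisk a Complex.I) (velocity (fun z => tube ε n (z, toDisk 1)) z) =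
      4 * ((1 + ‖a‖ ^ 2)⁻¹) ^ 2 * (s⁻¹ * ε) * n := by
    intro a z hz
    rw [orientationDet_spanningDisk, velocity_tube_one, ← hs, hz]
    have : (s : ℂ)⁻¹ * ((ε : ℂ) * (1 * ((n : ℂ) * Complex.I))) = ((s⁻¹ * ε * n : ℝ) :
      ℂ) * Complex.I := by
      push_cast
      ring
    simp only [this, Complex.im_ofReal_mul, Complex.I_im, mul_one]
    ring
  refine ⟨?_, spanningDisk, Set.univ, isOpen_univ, Set.subset_univ _,
    contDiff_spanningDisk.contDiffOn, fun a _ => spanningDisk_mem_S3 a, ?_, ?_, ?_⟩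
  · intro z w h
    have h1 := congrArg (fun p : S3 => p.1.2) h
    simp only [hcore, tube_one_val, ← hs] at h1
    exact mul_ne_zero (inv_ne_zero hsC) (mul_ne_zero hε' (zpow_ne_zero n (Circle.coe_ne_zero w)))
      h1.symm
  · intro z
    rw [hcore, spanningDisk, Circle.norm_coe]
    norm_num
  · intro a ha z h
    rw [hdet a z ((hpt a z).1 ⟨ha, h⟩).1]
    have : (n : ℝ) ≠ 0 := by exact_mod_cast hn
    positivity
  · let f : ℕ → ℂ × Circle := fun k => (zeta n ^ k / (s + ε),
      ⟨zeta n ^ k, by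
        have := norm_zeta_zpow hn k
        simpa [Submonoid.unitSphere] using this⟩)
    have hset : {x : ℂ × Circle | x.1 ∈ Metric.closedBall (0 : ℂ) 1 ∧
        spanningDisk x.1 = (tube ε n (x.2, toDisk 1)).1} = f '' (Finset.range n.natAbs) := by
      ext ⟨a, z⟩
      rw [Set.mem_ofPred_eq, hpt]
      constructor
      · rintro ⟨h1, h2⟩
        obtain ⟨k, hk, hkz⟩ := exists_zeta_pow_eq hn h1
        exact ⟨k, by simpa using hk, Prod.ext (by rw [h2, ← hkz]) (Circle.ext hkz)⟩
      · rintro ⟨k, -, h⟩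
        have h1 := congrArg Prod.fst h
        have h2 : zeta n ^ k = (z : ℂ) := congrArg (fun x : ℂ × Circle => (x.2 : ℂ)) h
        refine ⟨?_, ?_⟩
        · rw [← h2]
          exact_mod_cast zeta_zpow_zpow hn k
        · rw [← h2]
          exact h1.symm
    have hinj : Set.InjOn f (Finset.range n.natAbs) := by
      intro k hk l hl h
      refine (isPrimitiveRoot_zeta hn).pow_inj (by simpa using hk) (by simpa using hl) ?_
      exact congrArg (fun x : ℂ × Circle => (x.2 : ℂ)) h
    -- There are `|n|` intersections, one for each root of unity, and each counts `sign n`.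
    rw [hset, finsum_mem_image hinj, finsum_mem_coe_finset,
      Finset.sum_congr rfl (g := fun _ => n.sign), Finset.sum_const, Finset.card_range,
      nsmul_eq_mul, mul_comm, Int.sign_mul_natAbs]
    intro k _
    have hk : ((f k).2 : ℂ) ^ n = 1 := by exact_mod_cast zeta_zpow_zpow hn k
    rw [hdet _ _ hk]
    have hpos : 0 < 4 * ((1 + ‖(f k).1‖ ^ 2)⁻¹) ^ 2 * (s⁻¹ * ε) := by positivity
    rcases hn.lt_or_gt with h | h
    · rw [Int.sign_eq_neg_one_of_neg h, sign_neg (mul_neg_of_pos_of_neg hpos (by exact_mod_cast h))]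
      rfl
    · rw [Int.sign_eq_one_of_pos h, sign_pos (mul_pos hpos (by exact_mod_cast h))]
      rfl

theorem isFramedTube_tube {ε : ℝ} (hε : 0 < ε) {n : ℤ} (hn : n ≠ 0) :
    IsFramedTube unknot n (tube ε n) where
  embedding := isEmbedding_tube hε n
  smooth := ⟨tubeExt ε n, {x | x.1 ≠ 0}, isOpen_ne_fun continuous_fst continuous_const,
    fun x hx => (contDiffAt_tubeExt ε n hx).contDiffWithinAt, fun z w =>
      ⟨Circle.coe_ne_zero z, (tube_val ε n (z, w)).symm, tubeExt_immersion hε n z w⟩⟩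
  core := by
    refine congrArg Set.range (funext fun z => ?_)
    rw [tube_val, euclNorm_tubeVec]
    simp [tubeVec, center]
  neighborhood _ hp := mem_interior_of_mem_unknot hε n hp
  linking := hasLinkingNumber_tube hε hn

/-! ### Framing `-2` and real projective space -/

theorem antipodalSetoid_eq : antipodalSetoid = lensSetoid (-2) := by
  have hz : zeta (-2) = -1 := by
    rw [zeta, ← Complex.exp_pi_mul_I]
    congr 1
    norm_num
    ring
  refine Setoid.ext fun p q => ⟨?_, ?_⟩
  · rintro (h | h)
    · exact ⟨0, by simp [h]⟩
    · exact ⟨1, by simp [h, hz]⟩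
  · rintro ⟨k, hk⟩
    rw [hz] at hk
    rcases Int.even_or_odd k with h | h
    · left
      rw [hk, h.neg_one_zpow, one_smul]
    · right
      rw [hk, h.neg_one_zpow, neg_one_smul]

/-- The setoid is a variable so that the equality with `lensSetoid (-2)` can be substituted in the
quotient type, the atlas and the homeomorphism at once. -/
theorem surgery_neg_two {ε : ℝ} (hε : 0 < ε) {s : Setoid S3} (hs : s = lensSetoid (-2)) :
    IsClosedOrientedManifold (quotientAtlas s) ∧
      (∃! Ψ : Surgery (tube ε (-2)) ≃ₜ Quotient s,
        ∀ p, Ψ (complementInclusion ε (-2) p) = Quotient.mk s (rootMap (-2) p)) ∧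
      ∀ Ψ : Surgery (tube ε (-2)) ≃ₜ Quotient s,
        (∀ p, Ψ (complementInclusion ε (-2) p) = Quotient.mk s (rootMap (-2) p)) →
        HasDegree (surgeryAtlas ε (-2)) (quotientAtlas s) ⟨Ψ, Ψ.continuous⟩ 1 := by
  subst hs
  have hn : (-2 : ℤ) ≠ 0 := by norm_num
  exact ⟨isClosedOrientedManifold_quotientAtlas hn, existsUnique_homeomorph hε hn,
    hasDegree_of_extends hε hn⟩

end UnknotSurgery

end

theorem mainTheorem11 (n : ℤ) (hn : n ≠ 0) (ε : ℝ) (hε : 0 < ε) :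
    -- the tube is an admissible choice for surgery on the unknot with framing `n`
    IsFramedTube unknot n (tube ε n) ∧
    -- the complement of the unknot is a dense open subset of the surgered manifold
    (Topology.IsOpenEmbedding (complementInclusion ε n) ∧
      DenseRange (complementInclusion ε n) ∧
      ∀ (z w : Circle) (t : D2) (p : ↥(S3 \ unknot)) (a : D2) (r : ℝ), 0 < r →
        (t : ℂ) = r * w → (a : ℂ) = r * z → (p : ℂ × ℂ) = tube ε n (z, t) →
        complementInclusion ε n p = Quot.mk _ (Sum.inr (a, w))) ∧
    -- both spaces are closed connected oriented manifolds
    IsClosedOrientedManifold (surgeryAtlas ε n) ∧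
    IsClosedOrientedManifold (quotientAtlas (lensSetoid n)) ∧
    -- `i_n` does not depend on the choice of the root
    (∀ (p : ↥(S3 \ unknot)) (c : ℂ) (q : S3), c ^ n = (p.1.2 / (‖p.1.2‖ : ℂ))⁻¹ →
      q.1 = c • (p.1.1, (‖p.1.2‖ : ℂ)) → Quotient.mk (lensSetoid n) q = iMap n p) ∧
    -- `i_n` extends uniquely to a homeomorphism, and its degree is `-sign n`
    (∃! Φ : Surgery (tube ε n) ≃ₜ Lens n, ∀ p, Φ (complementInclusion ε n p) = iMap n p) ∧
    (∀ Φ : Surgery (tube ε n) ≃ₜ Lens n, (∀ p, Φ (complementInclusion ε n p) = iMap n p) →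
      HasDegree (surgeryAtlas ε n) (quotientAtlas (lensSetoid n)) ⟨Φ, Φ.continuous⟩
        (-n.sign)) ∧
    -- framing `-2`: a homeomorphism of degree one onto real projective space
    (n = -2 →
      IsClosedOrientedManifold (quotientAtlas antipodalSetoid) ∧
      (∃! Ψ : Surgery (tube ε n) ≃ₜ RP3,
        ∀ p, Ψ (complementInclusion ε n p) = Quotient.mk antipodalSetoid (rootMap n p)) ∧
      ∀ Ψ : Surgery (tube ε n) ≃ₜ RP3,
        (∀ p, Ψ (complementInclusion ε n p) = Quotient.mk antipodalSetoid (rootMap n p)) →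
        HasDegree (surgeryAtlas ε n) (quotientAtlas antipodalSetoid) ⟨Ψ, Ψ.continuous⟩ 1) := by
  refine ⟨isFramedTube_tube hε hn, ⟨isOpenEmbedding_complementInclusion hε hn,
    denseRange_complementInclusion hε hn, fun z w t p a r hr ht ha hp =>
      complementInclusion_tube hε hn hr ht ha hp⟩, isClosedOrientedManifold_surgeryAtlas hε hn,
    isClosedOrientedManifold_quotientAtlas hn, fun p c q hc hq => iMap_eq hn hc hq,
    existsUnique_homeomorph hε hn, hasDegree_of_extends hε hn, ?_⟩
  rintro rfl
  exact surgery_neg_two hε antipodalSetoid_eq
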